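/- Let $m\in\mathbb N$ and let $p,q_1,\dots,q_m,r$ be real numbers such that either $0<p,q_1,\dots,q_m<r<2$, or $r=2$ and $0<p,q_1,\dots,q_m<\infty$. Then there is a constant $C>0$, depending only on $m,p,q_1,\dots,q_m,r$, such that the following holds for all $\sigma$-finite measure spaces $(\Omega_1,\mu_1),\dots,(\Omega_m,\mu_m)$ and $(\Omega',\nu)$, and all countable (finite or infinite) families $\{f^i_{k_i}\}_{k_i}\subset L^{q_i}(\mu_i)$, $1\le i\le m$, where all the function spaces are real. (i) If $T\colon L^{q_1}(\mu_1)\times\cdots\times L^{q_m}(\mu_m)\to L^p(\nu)$ is a bounded multilinear operator, then $$\Big\|\Big(\sum_{k_1,\dots,k_m}|T(f^1_{k_1},\dots,f^m_{k_m})|^r\Big)^{1/r}\Big\|_{L^p(\nu)}\le C\,\|T\|\prod_{i=1}^m\Big\|\Big(\sum_{k_i}|f^i_{k_i}|^r\Big)^{1/r}\Big\|_{L^{q_i}(\mu_i)} .$$ (ii) If $T\colon L^{q_1}(\mu_1)\times\cdots\times L^{q_m}(\mu_m)\to L^{p,\infty}(\nu)$ is a bounded multilinear operator, then $$\Big\|\Big(\sum_{k_1,\dots,k_m}|T(f^1_{k_1},\dots,f^m_{k_m})|^r\Big)^{1/r}\Big\|_{L^{p,\infty}(\nu)}\le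 C\,e^{1/p}\,\|T\|_{weak}\prod_{i=1}^m\Big\|\Big(\sum_{k_i}|f^i_{k_i}|^r\Big)^{1/r}\Big\|_{L^{q_i}(\mu_i)} .$$ Here $\|g\|_{L^{p}(\nu)}=(\int|g|^p\,d\nu)^{1/p}$, $\|g\|_{L^{p,\infty}(\nu)}=\sup_{t>0}t\,\nu(\{|g|>t\})^{1/p}$, and $\|T\|$ (respectively $\|T\|_{weak}$) is the least $B\ge 0$ such that $\|T(f^1,\dots,f^m)\|\le B\prod_{i=1}^m\|f^i\|_{L^{q_i}(\mu_i)}$ for all $f^i\in L^{q_i}(\mu_i)$, with the norm of $L^p(\nu)$ (respectively $L^{p,\infty}(\nu)$) on the left. The sums and norms may take the value $\infty$, with $0\cdot\infty=0$. -/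

import Mathlib

open MeasureTheory
open scoped ENNReal

universe u v w

noncomputable section

/-- The pointwise `ℓ^r`-norm `ω ↦ (∑ₖ |gₖ(ω)|^r)^{1/r}` of a family of real functions,
with values in `[0, ∞]`. -/
def lrNorm {κ : Type*} {Ω : Type*} (r : ℝ) (g : κ → Ω → ℝ) (ω : Ω) : ℝ≥0∞ :=
  (∑' k, ‖g k ω‖ₑ ^ r) ^ (1 / r)

/-- The weak `L^p` quasi-norm `sup_{t > 0} t · ν(|g| > t)^{1/p}`, with values in `[0, ∞]`. -/
def eWeakLpNorm {Ω : Type*} [MeasurableSpace Ω] {ε : Type*} [ENorm ε]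
    (g : Ω → ε) (p : ℝ) (ν : Measure Ω) : ℝ≥0∞ :=
  ⨆ (t : ℝ) (_ : 0 < t), ENNReal.ofReal t * ν {ω | ENNReal.ofReal t < ‖g ω‖ₑ} ^ (1 / p)

theorem eWeakLpNorm_congr_ae {Ω : Type*} [MeasurableSpace Ω] {ε : Type*} [ENorm ε]
    {g h : Ω → ε} {p : ℝ} {ν : Measure Ω} (H : g =ᵐ[ν] h) :
    eWeakLpNorm g p ν = eWeakLpNorm h p ν := by
  unfold eWeakLpNorm
  refine iSup_congr fun t => iSup_congr fun _ => ?_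
  congr 2
  refine measure_congr ?_
  filter_upwards [H] with ω hω
  change (ENNReal.ofReal t < ‖g ω‖ₑ) = (ENNReal.ofReal t < ‖h ω‖ₑ)
  rw [hω]

theorem eWeakLpNorm_zero {Ω : Type*} [MeasurableSpace Ω] {p : ℝ} (hp : 0 < p)
    (ν : Measure Ω) : eWeakLpNorm (0 : Ω → ℝ) p ν = 0 := by
  simp [eWeakLpNorm, hp]

theorem eWeakLpNorm_add_lt_top {Ω : Type*} [MeasurableSpace Ω] {p : ℝ} (hp : 0 < p)
    {ν : Measure Ω} {g h : Ω → ℝ} (hg : eWeakLpNorm g p ν < ∞) (hh : eWeakLpNorm h p ν < ∞) :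
    eWeakLpNorm (g + h) p ν < ∞ := by
  set A := eWeakLpNorm g p ν with hA
  set B := eWeakLpNorm h p ν with hB
  have key : eWeakLpNorm (g + h) p ν ≤ 2 * (2 ^ (1 / p) * (A + B)) := by
    refine iSup₂_le fun t ht => ?_
    have ht2 : ENNReal.ofReal t = 2 * ENNReal.ofReal (t / 2) := by
      rw [← ENNReal.ofReal_ofNat 2, ← ENNReal.ofReal_mul (by norm_num)]
      congr 1
      ring
    have hgA : ENNReal.ofReal (t / 2) * ν {ω | ENNReal.ofReal (t / 2) < ‖g ω‖ₑ} ^ (1 / p) ≤ A :=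
      le_iSup₂_of_le (f := fun (s : ℝ) (_ : 0 < s) =>
        ENNReal.ofReal s * ν {ω | ENNReal.ofReal s < ‖g ω‖ₑ} ^ (1 / p)) (t / 2) (half_pos ht) le_rfl
    have hhB : ENNReal.ofReal (t / 2) * ν {ω | ENNReal.ofReal (t / 2) < ‖h ω‖ₑ} ^ (1 / p) ≤ B :=
      le_iSup₂_of_le (f := fun (s : ℝ) (_ : 0 < s) =>
        ENNReal.ofReal s * ν {ω | ENNReal.ofReal s < ‖h ω‖ₑ} ^ (1 / p)) (t / 2) (half_pos ht) le_rfl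
    set a := ν {ω | ENNReal.ofReal (t / 2) < ‖g ω‖ₑ}
    set b := ν {ω | ENNReal.ofReal (t / 2) < ‖h ω‖ₑ}
    have hsub : ν {ω | ENNReal.ofReal t < ‖(g + h) ω‖ₑ} ≤ a + b := by
      refine (measure_mono ?_).trans (measure_union_le _ _)
      intro ω hω
      by_contra hc
      simp only [Set.mem_union, Set.mem_ofPred_eq, not_or, not_lt] at hc hω
      refine absurd hω (not_lt.2 ?_)
      calc ‖(g + h) ω‖ₑ ≤ ‖g ω‖ₑ + ‖h ω‖ₑ := enorm_add_le _ _
        _ ≤ ENNReal.ofReal (t / 2) + ENNReal.ofReal (t / 2) := add_le_add hc.1 hc.2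
        _ = ENNReal.ofReal t := by rw [ht2, two_mul]
    have hp' : 0 ≤ 1 / p := by positivity
    have hab : (a + b) ^ (1 / p) ≤ 2 ^ (1 / p) * (a ^ (1 / p) + b ^ (1 / p)) := by
      have h1 : a + b ≤ 2 * max a b := by
        rw [two_mul]
        exact add_le_add (le_max_left _ _) (le_max_right _ _)
      refine (ENNReal.rpow_le_rpow h1 hp').trans ?_
      rw [ENNReal.mul_rpow_of_nonneg _ _ hp']
      gcongr
      rcases le_total a b with hle | hle
      · rw [max_eq_right hle]
        exact le_add_self
      · rw [max_eq_left hle]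
        exact le_self_add
    calc ENNReal.ofReal t * ν {ω | ENNReal.ofReal t < ‖(g + h) ω‖ₑ} ^ (1 / p)
        ≤ (2 * ENNReal.ofReal (t / 2)) * (2 ^ (1 / p) * (a ^ (1 / p) + b ^ (1 / p))) := by
          rw [ht2]
          gcongr
          refine le_trans (ENNReal.rpow_le_rpow ?_ hp') hab
          rw [← ht2]
          exact hsub
      _ = 2 * (2 ^ (1 / p) * (ENNReal.ofReal (t / 2) * a ^ (1 / p)
            + ENNReal.ofReal (t / 2) * b ^ (1 / p))) := by ring
      _ ≤ 2 * (2 ^ (1 / p) * (A + B)) := by gcongr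
  refine key.trans_lt ?_
  have h2 : (2 : ℝ≥0∞) ^ (1 / p) < ∞ :=
    ENNReal.rpow_lt_top_of_nonneg (by positivity) (by norm_num)
  exact ENNReal.mul_lt_top (by norm_num) (ENNReal.mul_lt_top h2 (ENNReal.add_lt_top.2 ⟨hg, hh⟩))

theorem eWeakLpNorm_smul_lt_top {Ω : Type*} [MeasurableSpace Ω] {p : ℝ} (hp : 0 < p)
    {ν : Measure Ω} (c : ℝ) {g : Ω → ℝ} (hg : eWeakLpNorm g p ν < ∞) :
    eWeakLpNorm (c • g) p ν < ∞ := by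
  rcases eq_or_ne c 0 with rfl | hc
  · rw [zero_smul, eWeakLpNorm_zero hp]
    exact ENNReal.zero_lt_top
  have hc' : 0 < |c| := abs_pos.2 hc
  refine lt_of_le_of_lt (b := ENNReal.ofReal |c| * eWeakLpNorm g p ν) ?_
    (ENNReal.mul_lt_top ENNReal.ofReal_lt_top hg)
  refine iSup₂_le fun t ht => ?_
  have ht2 : ENNReal.ofReal t = ENNReal.ofReal |c| * ENNReal.ofReal (t / |c|) := by
    rw [← ENNReal.ofReal_mul hc'.le]
    congr 1
    field_simp
  have hset : {ω | ENNReal.ofReal t < ‖(c • g) ω‖ₑ} =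
      {ω | ENNReal.ofReal (t / |c|) < ‖g ω‖ₑ} := by
    ext ω
    simp only [Set.mem_ofPred_eq, Pi.smul_apply, smul_eq_mul, Real.enorm_eq_ofReal_abs, abs_mul]
    rw [ENNReal.ofReal_lt_ofReal_iff_of_nonneg ht.le,
      ENNReal.ofReal_lt_ofReal_iff_of_nonneg (by positivity), div_lt_iff₀ hc', mul_comm]
  rw [hset, ht2, mul_assoc]
  gcongr
  exact le_iSup₂_of_le (f := fun (s : ℝ) (_ : 0 < s) =>
    ENNReal.ofReal s * ν {ω | ENNReal.ofReal s < ‖g ω‖ₑ} ^ (1 / p)) (t / |c|) (by positivity) le_rfl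

/-- The real space weak `L^p`, i.e. `L^{p,∞}(ν)`, for `0 < p < ∞`: classes modulo almost everywhere
equality of measurable functions with finite weak `L^p` quasi-norm. -/
def WeakLp {Ω : Type*} [MeasurableSpace Ω] (p : ℝ) (hp : 0 < p) (ν : Measure Ω) :
    Submodule ℝ (Ω →ₘ[ν] ℝ) where
  carrier := {g | eWeakLpNorm g p ν < ∞}
  zero_mem' := by
    change eWeakLpNorm _ p ν < ∞
    rw [eWeakLpNorm_congr_ae AEEqFun.coeFn_zero, eWeakLpNorm_zero hp]
    exact ENNReal.zero_lt_top
  add_mem' := by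
    intro g h hg hh
    change eWeakLpNorm _ p ν < ∞
    rw [eWeakLpNorm_congr_ae (AEEqFun.coeFn_add g h)]
    exact eWeakLpNorm_add_lt_top hp hg hh
  smul_mem' := by
    intro c g hg
    change eWeakLpNorm _ p ν < ∞
    rw [eWeakLpNorm_congr_ae (AEEqFun.coeFn_smul c g)]
    exact eWeakLpNorm_smul_lt_top hp c hg

instance WeakLp.instENorm {Ω : Type*} [MeasurableSpace Ω] (p : ℝ) (hp : 0 < p)
    (ν : Measure Ω) : ENorm (WeakLp p hp ν) where
  enorm g := eWeakLpNorm (g : Ω →ₘ[ν] ℝ) p ν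

/-- The (quasi-)norm of a multilinear operator between (quasi-)normed spaces: the least
`B ∈ [0, ∞]` with `‖T x‖ ≤ B ∏ᵢ ‖xᵢ‖` for all `x`. -/
def multilinearOpNorm {ι : Type*} [Fintype ι] {E : ι → Type*} {F : Type*}
    [∀ i, AddCommMonoid (E i)] [∀ i, Module ℝ (E i)] [AddCommMonoid F] [Module ℝ F]
    [∀ i, ENorm (E i)] [ENorm F] (T : MultilinearMap ℝ E F) : ℝ≥0∞ :=
  sInf {B : ℝ≥0∞ | ∀ x : ∀ i, E i, ‖T x‖ₑ ≤ B * ∏ i, ‖x i‖ₑ}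

/-- A multilinear operator is bounded when its norm is finite. -/
def IsBoundedMultilinear {ι : Type*} [Fintype ι] {E : ι → Type*} {F : Type*}
    [∀ i, AddCommMonoid (E i)] [∀ i, Module ℝ (E i)] [AddCommMonoid F] [Module ℝ F]
    [∀ i, ENorm (E i)] [ENorm F] (T : MultilinearMap ℝ E F) : Prop :=
  multilinearOpNorm T < ∞

end

/-! Each family `f^i` is replaced by one random function `∑ₖ Xᵢₖ(ω) f^i_k`, where the `Xᵢₖ` are
independent and imitate symmetric `r`-stable variables: standard gaussians if `r = 2`, products `g ·
U ^ (-1/r)` of a gaussian and a power of a uniform variable if `r < 2`. By multilinearity, `T` sends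
these functions to `S(ω, y) = ∑ₖ T(f_k)(y) ∏ᵢ Xᵢₖᵢ(ω)`.

Two estimates are played against each other. The `qᵢ`-th moments of `∑ₖ aₖ Xᵢₖ` are controlled by
the `ℓ^r`-norm of `a`, so Markov's inequality gives a set `G` of `ω`, the same for all `y`, on which
every random function has `L^{qᵢ}`-size at most a constant times the right-hand norm of its family.
On the other hand, for each `y`, `|S(ω, y)|` is at least a constant times the `ℓ^r`-norm of
`(T(f_k)(y))ₖ` on a part of `G` of probability at least `τ`. Fubini on `G × Ω'` then transfers any
bound on `∫ F(|T x|)`, with `F` monotone, to the `ℓ^r`-norm. The choice `F(x) = x ^ p` gives (i) and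
the indicator of a half-line gives (ii); no triangle inequality in the target is needed.

The lower estimate is stated for the truncated moment `E min(|Y|^r, L)`: the full moment is infinite
for `r < 2`, and the truncated form survives products of families. The argument is carried by
`exists_random_family`, `exists_random_families` and `exists_finite_transfer`. -/

/-! ### Gaussian sums: characteristic functions and moments -/

open ProbabilityTheory in
theorem integral_cos_sum_gaussian {ι : Type*} [Fintype ι] (a : ι → ℝ) :
    ∫ g, Real.cos (∑ k, a k * g k) ∂(Measure.pi fun _ : ι => gaussianReal 0 1)
      = Real.exp (-(∑ k, a k ^ 2) / 2) := by
  have h1 : ∫ g : ι → ℝ, Complex.exp ((∑ k, a k * g k : ℝ) * Complex.I)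
      ∂(Measure.pi fun _ : ι => gaussianReal 0 1) = Complex.exp (-(∑ k, a k ^ 2 : ℝ) / 2) := by
    have h2 : ∀ g : ι → ℝ, Complex.exp ((∑ k, a k * g k : ℝ) * Complex.I)
        = ∏ k, Complex.exp ((a k) * (g k) * Complex.I) := by
      intro g
      rw [← Complex.exp_sum, ← Finset.sum_mul]
      push_cast
      rfl
    simp_rw [h2]
    rw [integral_fintype_prod_eq_prod (𝕜 := ℂ) (f := fun k (x : ℝ) => Complex.exp ((a k) * x * Complex.I))]
    have h3 : ∀ k, ∫ x : ℝ, Complex.exp ((a k) * x * Complex.I) ∂(gaussianReal 0 1)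
        = Complex.exp (-(a k : ℂ) ^ 2 / 2) := by
      intro k
      have := charFun_gaussianReal (μ := 0) (v := 1) (a k)
      rw [charFun_apply_real] at this
      rw [this]
      congr 1
      push_cast
      ring
    simp_rw [h3]
    rw [← Complex.exp_sum, ← Finset.sum_div, Finset.sum_neg_distrib]
    push_cast
    rfl
  have hint : Integrable (fun g : ι → ℝ => Complex.exp ((∑ k, a k * g k : ℝ) * Complex.I))
      (Measure.pi fun _ : ι => gaussianReal 0 1) := by
    refine Integrable.of_bound (C := 1)
      (Measurable.aestronglyMeasurable (by fun_prop)) (Filter.Eventually.of_forall fun g => ?_)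
    rw [Complex.norm_exp_ofReal_mul_I]
  have h4 := congrArg Complex.re h1
  rw [← RCLike.re_eq_complex_re, ← integral_re hint] at h4
  have h5 : (-(∑ k, a k ^ 2 : ℝ) / 2 : ℂ) = ((-(∑ k, a k ^ 2) / 2 : ℝ) : ℂ) := by push_cast; rfl
  rw [h5, RCLike.re_eq_complex_re, Complex.exp_ofReal_re] at h4
  simp_rw [Complex.exp_ofReal_mul_I_re] at h4
  exact h4

/-- A minorant of the truncated power whose expectation is read off the characteristic function.
Near zero it is quadratic, which is where `r ≤ 2` enters. -/
theorem half_one_sub_cos_le_min {r : ℝ} (hr : 0 < r) (hr2 : r ≤ 2) (x : ℝ) :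
    (1 - Real.cos x) / 2 ≤ min (|x| ^ r) 1 := by
  refine le_min ?_ (by linarith [Real.neg_one_le_cos x])
  rcases le_total |x| 1 with h | h
  · have h1 := Real.one_sub_sq_div_two_le_cos (x := x)
    have h2 : |x| ^ (2 : ℝ) ≤ |x| ^ r :=
      Real.rpow_le_rpow_of_exponent_ge' (abs_nonneg _) h hr.le hr2
    rw [Real.rpow_two, sq_abs] at h2
    nlinarith [sq_nonneg x]
  · have := Real.one_le_rpow h hr.le
    linarith [Real.neg_one_le_cos x]

theorem ofReal_half_one_sub_cos_le_lintegral_min {A : Type*} [MeasurableSpace A] {P : Measure A}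
    [IsProbabilityMeasure P] {r : ℝ} (hr : 0 < r) (hr2 : r ≤ 2) {S : A → ℝ} (hS : Measurable S) :
    ENNReal.ofReal ((1 - ∫ ω, Real.cos (S ω) ∂P) / 2) ≤ ∫⁻ ω, min (‖S ω‖ₑ ^ r) 1 ∂P := by
  have hint : Integrable (fun ω => Real.cos (S ω)) P :=
    Integrable.of_bound (C := 1) (by fun_prop) (Filter.Eventually.of_forall fun g =>
      Real.abs_cos_le_one _)
  have h1 : (1 - ∫ ω, Real.cos (S ω) ∂P) / 2 = ∫ ω, (1 - Real.cos (S ω)) / 2 ∂P := by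
    rw [integral_div, integral_sub (integrable_const _) hint]
    simp
  rw [h1, ofReal_integral_eq_lintegral_ofReal (f := fun ω => (1 - Real.cos (S ω)) / 2) (((integrable_const _).sub hint).div_const _)
    (Filter.Eventually.of_forall fun ω => by
      have := Real.cos_le_one (S ω)
      simp only [Pi.zero_apply]
      linarith)]
  refine lintegral_mono fun ω => ?_
  refine (ENNReal.ofReal_le_ofReal (half_one_sub_cos_le_min hr hr2 (S ω))).trans ?_
  rw [ENNReal.ofReal_min, ENNReal.ofReal_one, ← ENNReal.ofReal_rpow_of_nonneg (abs_nonneg _) hr.le,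
    Real.enorm_eq_ofReal_abs]

/-- Reduces all gaussian moments to the exponential moment, which is explicit for linear
combinations. -/
theorem abs_rpow_le_mul_exp_add_exp_neg {q : ℝ} (hq : 0 < q) :
    ∃ K : ℝ, 0 < K ∧ ∀ x : ℝ, |x| ^ q ≤ K * (Real.exp x + Real.exp (-x)) := by
  refine ⟨1 + (Nat.factorial ⌈q⌉₊ : ℝ), by positivity, fun x => ?_⟩
  have h0 : Real.exp |x| ≤ Real.exp x + Real.exp (-x) := by
    rcases abs_choice x with h | h <;> rw [h] <;> linarith [Real.exp_pos x, Real.exp_pos (-x)]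
  have h1 : |x| ^ q ≤ 1 + |x| ^ ⌈q⌉₊ := by
    rcases le_total |x| 1 with h | h
    · have := Real.rpow_le_one (abs_nonneg x) h hq.le
      have : 0 ≤ |x| ^ ⌈q⌉₊ := by positivity
      linarith
    · have := Real.rpow_le_rpow_of_exponent_le h (Nat.le_ceil q)
      rw [Real.rpow_natCast] at this
      linarith
  have h2 : |x| ^ ⌈q⌉₊ ≤ (Nat.factorial ⌈q⌉₊ : ℝ) * Real.exp |x| := by
    have := Real.pow_div_factorial_le_exp |x| (abs_nonneg x) ⌈q⌉₊
    rwa [div_le_iff₀ (by positivity), mul_comm] at this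
  have h3 : 1 ≤ Real.exp |x| := Real.one_le_exp (abs_nonneg _)
  calc |x| ^ q ≤ (1 + (Nat.factorial ⌈q⌉₊ : ℝ)) * Real.exp |x| := by linarith
    _ ≤ _ := by gcongr

open ProbabilityTheory in
theorem integral_exp_sum_gaussian {ι : Type*} [Fintype ι] (a : ι → ℝ) :
    ∫ g, Real.exp (∑ k, a k * g k) ∂(Measure.pi fun _ : ι => gaussianReal 0 1)
      = Real.exp ((∑ k, a k ^ 2) / 2) := by
  simp_rw [Real.exp_sum]
  rw [integral_fintype_prod_eq_prod (𝕜 := ℝ) (f := fun k x => Real.exp (a k * x))]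
  have h3 : ∀ k, ∫ x : ℝ, Real.exp (a k * x) ∂(gaussianReal 0 1) = Real.exp (a k ^ 2 / 2) := by
    intro k
    have := congrFun (mgf_id_gaussianReal (μ := 0) (v := 1)) (a k)
    simp only [mgf, id] at this
    rw [this]
    simp
  simp_rw [h3]
  rw [← Real.exp_sum, ← Finset.sum_div]

open ProbabilityTheory in
theorem lintegral_exp_sum_gaussian {ι : Type*} [Fintype ι] (a : ι → ℝ) :
    ∫⁻ g, ENNReal.ofReal (Real.exp (∑ k, a k * g k)) ∂(Measure.pi fun _ : ι => gaussianReal 0 1)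
      = ENNReal.ofReal (Real.exp ((∑ k, a k ^ 2) / 2)) := by
  rw [← integral_exp_sum_gaussian, ofReal_integral_eq_lintegral_ofReal]
  · by_contra h
    have := integral_exp_sum_gaussian a
    rw [integral_undef h] at this
    exact (Real.exp_pos _).ne this
  · exact Filter.Eventually.of_forall fun _ => (Real.exp_pos _).le

/-! ### Reduction to coefficients of unit `ℓ^r`-size -/

theorem enorm_rpow_eq_ofReal {r : ℝ} (hr : 0 ≤ r) (x : ℝ) :
    ‖x‖ₑ ^ r = ENNReal.ofReal (|x| ^ r) := by
  rw [Real.enorm_eq_ofReal_abs, ENNReal.ofReal_rpow_of_nonneg (abs_nonneg _) hr]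

theorem sum_enorm_rpow_eq_ofReal {ι : Type*} [Fintype ι] {r : ℝ} (hr : 0 ≤ r) (a : ι → ℝ) :
    ∑ k, ‖a k‖ₑ ^ r = ENNReal.ofReal (∑ k, |a k| ^ r) := by
  rw [ENNReal.ofReal_sum_of_nonneg fun k _ => by positivity]
  exact Finset.sum_congr rfl fun k _ => enorm_rpow_eq_ofReal hr _

/-- A nonzero vector is a multiple of a vector of `ℓ^r`-size one. -/
theorem exists_normalized {ι : Type*} [Fintype ι] {r : ℝ} (hr : 0 < r) (a : ι → ℝ)
    (ha : a ≠ 0) : ∃ (t : ℝ) (b : ι → ℝ), (∀ k, a k = t * b k) ∧ ∑ k, ‖b k‖ₑ ^ r = 1 ∧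
      ∑ k, ‖a k‖ₑ ^ r = ‖t‖ₑ ^ r := by
  obtain ⟨k₀, hk₀⟩ := Function.ne_iff.1 ha
  have hpos : 0 < ∑ k, |a k| ^ r :=
    lt_of_lt_of_le (Real.rpow_pos_of_pos (abs_pos.2 hk₀) r)
      (Finset.single_le_sum (f := fun k => |a k| ^ r) (fun k _ => by positivity)
        (Finset.mem_univ k₀))
  set L := ∑ k, |a k| ^ r with hL
  have ht : 0 < L ^ (1 / r) := by positivity
  have htr : (L ^ (1 / r)) ^ r = L := by
    rw [← Real.rpow_mul hpos.le, one_div_mul_cancel hr.ne', Real.rpow_one]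
  refine ⟨L ^ (1 / r), fun k => a k / L ^ (1 / r), fun k => by field_simp, ?_, ?_⟩
  · rw [sum_enorm_rpow_eq_ofReal hr.le]
    have : ∀ k, |a k / L ^ (1 / r)| ^ r = |a k| ^ r / L := by
      intro k
      rw [abs_div, abs_of_pos ht, Real.div_rpow (abs_nonneg _) ht.le, htr]
    simp_rw [this]
    rw [← Finset.sum_div, ← hL, div_self hpos.ne', ENNReal.ofReal_one]
  · rw [sum_enorm_rpow_eq_ofReal hr.le, enorm_rpow_eq_ofReal hr.le, abs_of_pos ht, htr]

/-- Homogeneity: the truncation level is the `ℓ^r`-sum itself, so it scales together with the random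
sum. -/
theorem lower_bound_of_normalized {ι A : Type*} [Fintype ι] [MeasurableSpace A] {P : Measure A}
    {X : ι → A → ℝ} {r : ℝ} (hr : 0 < r) {θ : ℝ≥0∞}
    (h : ∀ a : ι → ℝ, ∑ k, ‖a k‖ₑ ^ r = 1 →
      θ ≤ ∫⁻ ω, min (‖∑ k, a k * X k ω‖ₑ ^ r) 1 ∂P) (a : ι → ℝ) :
    θ * ∑ k, ‖a k‖ₑ ^ r ≤
      ∫⁻ ω, min (‖∑ k, a k * X k ω‖ₑ ^ r) (∑ k, ‖a k‖ₑ ^ r) ∂P := by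
  rcases eq_or_ne a 0 with rfl | ha
  · simp [hr]
  obtain ⟨t, b, hab, hb, hat⟩ := exists_normalized hr a ha
  rw [hat]
  have h1 : ∀ ω, min (‖∑ k, a k * X k ω‖ₑ ^ r) (‖t‖ₑ ^ r)
      = ‖t‖ₑ ^ r * min (‖∑ k, b k * X k ω‖ₑ ^ r) 1 := by
    intro ω
    have : ∑ k, a k * X k ω = t * ∑ k, b k * X k ω := by
      rw [Finset.mul_sum]
      exact Finset.sum_congr rfl fun k _ => by rw [hab k, mul_assoc]
    rw [this, enorm_mul, ENNReal.mul_rpow_of_nonneg _ _ hr.le]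
    rw [mul_min, mul_one]
  simp_rw [h1]
  rw [lintegral_const_mul' _ _ (ENNReal.rpow_ne_top_of_nonneg hr.le enorm_ne_top), mul_comm]
  gcongr
  exact h b hb

theorem upper_bound_of_normalized {ι A : Type*} [Fintype ι] [MeasurableSpace A] {P : Measure A}
    {X : ι → A → ℝ} {r q : ℝ} (hr : 0 < r) (hq : 0 < q) {K : ℝ≥0∞}
    (h : ∀ a : ι → ℝ, ∑ k, ‖a k‖ₑ ^ r = 1 →
      ∫⁻ ω, ‖∑ k, a k * X k ω‖ₑ ^ q ∂P ≤ K) (a : ι → ℝ) :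
    ∫⁻ ω, ‖∑ k, a k * X k ω‖ₑ ^ q ∂P ≤ K * (∑ k, ‖a k‖ₑ ^ r) ^ (q / r) := by
  rcases eq_or_ne a 0 with rfl | ha
  · simp [hq]
  obtain ⟨t, b, hab, hb, hat⟩ := exists_normalized hr a ha
  rw [hat, ← ENNReal.rpow_mul, mul_div_cancel₀ _ hr.ne']
  have h1 : ∀ ω, ‖∑ k, a k * X k ω‖ₑ ^ q = ‖t‖ₑ ^ q * ‖∑ k, b k * X k ω‖ₑ ^ q := by
    intro ω
    have : ∑ k, a k * X k ω = t * ∑ k, b k * X k ω := by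
      rw [Finset.mul_sum]
      exact Finset.sum_congr rfl fun k _ => by rw [hab k, mul_assoc]
    rw [this, enorm_mul, ENNReal.mul_rpow_of_nonneg _ _ hq.le]
  simp_rw [h1]
  rw [lintegral_const_mul' _ _ (ENNReal.rpow_ne_top_of_nonneg hq.le enorm_ne_top), mul_comm]
  gcongr
  exact h b hb

open ProbabilityTheory in
theorem lintegral_gaussian_sum_rpow_le {q : ℝ} (hq : 0 < q) :
    ∃ K : ℝ≥0∞, K ≠ ∞ ∧ ∀ (ι : Type w) [Fintype ι] (a : ι → ℝ),
      ∫⁻ g, ‖∑ k, a k * g k‖ₑ ^ q ∂(Measure.pi fun _ : ι => gaussianReal 0 1)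
        ≤ K * (∑ k, ‖a k‖ₑ ^ (2 : ℝ)) ^ (q / 2) := by
  obtain ⟨K, hK, hKx⟩ := abs_rpow_le_mul_exp_add_exp_neg hq
  refine ⟨ENNReal.ofReal K * (ENNReal.ofReal (Real.exp (1 / 2)) +
    ENNReal.ofReal (Real.exp (1 / 2))), by finiteness, fun ι _ a => ?_⟩
  refine upper_bound_of_normalized (X := fun k (g : ι → ℝ) => g k) two_pos hq (fun b hb => ?_) a
  have hb2 : ∑ k, b k ^ 2 = 1 := by
    rw [sum_enorm_rpow_eq_ofReal zero_le_two, ENNReal.ofReal_eq_one] at hb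
    simpa using hb
  calc ∫⁻ g, ‖∑ k, b k * g k‖ₑ ^ q ∂(Measure.pi fun _ : ι => gaussianReal 0 1)
      ≤ ∫⁻ g, ENNReal.ofReal K * (ENNReal.ofReal (Real.exp (∑ k, b k * g k))
          + ENNReal.ofReal (Real.exp (∑ k, (-b k) * g k)))
          ∂(Measure.pi fun _ : ι => gaussianReal 0 1) := by
        refine lintegral_mono fun g => ?_
        rw [enorm_rpow_eq_ofReal hq.le, ← ENNReal.ofReal_add (Real.exp_pos _).le
          (Real.exp_pos _).le, ← ENNReal.ofReal_mul hK.le]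
        simp_rw [neg_mul, Finset.sum_neg_distrib]
        exact ENNReal.ofReal_le_ofReal (hKx _)
    _ = _ := by
        rw [lintegral_const_mul' _ _ ENNReal.ofReal_ne_top, lintegral_add_left (by fun_prop),
          lintegral_exp_sum_gaussian, lintegral_exp_sum_gaussian]
        simp [hb2]

/-! ### Heavy-tailed factors for `r < 2` -/

/-- The uniform distribution on the unit interval. -/
noncomputable def unitUniform : Measure ℝ := volume.restrict (Set.Ioc 0 1)

instance : IsProbabilityMeasure unitUniform := ⟨by simp [unitUniform]⟩

/-- The event `|a| U ^ (-1/r) ≥ 1` is `U ≤ |a| ^ r`, of probability `|a| ^ r` because `|a| ≤ 1`, and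
there the integrand is at most `e ^ (-1/2)`. The bound `exp (-κ |a| ^ r)` has the shape of a stable
characteristic function, so it multiplies well over independent coordinates. -/
theorem integral_exp_neg_sq_uniform_le {r a : ℝ} (hr : 0 < r) (ha : |a| ≤ 1) :
    ∫ x, Real.exp (-(a * x ^ (-1 / r)) ^ 2 / 2) ∂unitUniform
      ≤ Real.exp (-((1 - Real.exp (-1 / 2)) * |a| ^ r)) := by
  set κ := 1 - Real.exp (-1 / 2) with hκ
  have hκ0 : Real.exp (-1 / 2) ≤ 1 := by rw [Real.exp_le_one_iff]; norm_num
  have har : |a| ^ r ≤ 1 := Real.rpow_le_one (abs_nonneg _) ha hr.le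
  have har0 : 0 ≤ |a| ^ r := by positivity
  have hint : Integrable (fun x => (1 : ℝ) - (Set.Ioc 0 (|a| ^ r)).indicator (fun _ => κ) x)
      unitUniform :=
    (integrable_const _).sub ((integrable_const _).indicator measurableSet_Ioc)
  calc ∫ x, Real.exp (-(a * x ^ (-1 / r)) ^ 2 / 2) ∂unitUniform
      ≤ ∫ x, (1 - (Set.Ioc 0 (|a| ^ r)).indicator (fun _ => κ) x) ∂unitUniform := by
        refine integral_mono (Integrable.of_bound (C := 1)
          (Measurable.aestronglyMeasurable (by fun_prop)) (Filter.Eventually.of_forall fun x => ?_))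
          hint fun x => ?_
        · rw [Real.norm_eq_abs, Real.abs_exp, Real.exp_le_one_iff]
          have := sq_nonneg (a * x ^ (-1 / r))
          linarith
        · by_cases hx : x ∈ Set.Ioc 0 (|a| ^ r)
          · simp only [Set.indicator_of_mem hx]
            rw [hκ, sub_sub_cancel]
            refine Real.exp_le_exp.2 ?_
            have h1 : 1 ≤ |a| * x ^ (-1 / r) := by
              have h2 : x ^ (1 / r) ≤ |a| := by
                have := Real.rpow_le_rpow hx.1.le hx.2 (by positivity : 0 ≤ 1 / r)
                rwa [← Real.rpow_mul (abs_nonneg _), mul_one_div_cancel hr.ne',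
                  Real.rpow_one] at this
              rw [neg_div, Real.rpow_neg hx.1.le, ← div_eq_mul_inv,
                one_le_div (Real.rpow_pos_of_pos hx.1 _)]
              exact h2
            have h3 : 1 ≤ (|a| * x ^ (-1 / r)) ^ 2 := one_le_pow₀ h1
            rw [mul_pow, sq_abs, ← mul_pow] at h3
            linarith
          · simp only [Set.indicator_of_notMem hx, sub_zero]
            rw [Real.exp_le_one_iff]
            have := sq_nonneg (a * x ^ (-1 / r))
            linarith
    _ = 1 - κ * |a| ^ r := by
        rw [integral_sub (integrable_const _)
          ((integrable_const _).indicator measurableSet_Ioc), integral_indicator measurableSet_Ioc]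
        have : unitUniform.real (Set.Ioc 0 (|a| ^ r)) = |a| ^ r := by
          rw [measureReal_def, unitUniform, Measure.restrict_apply measurableSet_Ioc,
            Set.inter_eq_left.2 (Set.Ioc_subset_Ioc_right har), Real.volume_Ioc, sub_zero,
            ENNReal.toReal_ofReal har0]
        simp [this, mul_comm]
    _ ≤ _ := Real.one_sub_le_exp_neg _

/-- The power `x ^ (-(1/ρ))` is not integrable at zero, hence the truncation. The split point `c =
(b/t) ^ ρ` is where the two terms of the minimum agree; it may exceed `1`, so the integral is
enlarged to the half-line. -/
theorem lintegral_min_uniform_le {ρ b t : ℝ} (hρ : 0 < ρ) (hρ1 : ρ < 1) (hb : 0 < b)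
    (ht : 0 < t) :
    ∫⁻ x, min (ENNReal.ofReal (b * x ^ (-(1 / ρ)))) (ENNReal.ofReal t) ∂unitUniform
      ≤ ENNReal.ofReal ((1 + 1 / (1 / ρ - 1)) * (b ^ ρ * t ^ (1 - ρ))) := by
  have hρ2 : 1 < 1 / ρ := by rwa [one_lt_div hρ]
  set c := (b / t) ^ ρ with hc
  have hc0 : 0 < c := by positivity
  have h1 : t * c = b ^ ρ * t ^ (1 - ρ) := by
    rw [hc, Real.div_rpow hb.le ht.le, Real.rpow_sub ht, Real.rpow_one]
    field_simp
  have h2 : b * c ^ (-(1 / ρ) + 1) = b ^ ρ * t ^ (1 - ρ) := by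
    rw [← h1, Real.rpow_add hc0, Real.rpow_one, Real.rpow_neg hc0.le]
    have : c ^ (1 / ρ) = b / t := by
      rw [hc, ← Real.rpow_mul (by positivity), mul_one_div_cancel hρ.ne', Real.rpow_one]
    rw [this]
    field_simp
  have hI : ∫⁻ x in Set.Ioi c, ENNReal.ofReal (b * x ^ (-(1 / ρ)))
      = ENNReal.ofReal (1 / (1 / ρ - 1) * (b ^ ρ * t ^ (1 - ρ))) := by
    rw [← ofReal_integral_eq_lintegral_ofReal]
    · rw [integral_const_mul, integral_Ioi_rpow_of_lt (by linarith) hc0, ← h2]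
      congr 1
      rw [show -(1 / ρ) + 1 = -(1 / ρ - 1) by ring]
      rw [neg_div_neg_eq]
      ring
    · exact (integrableOn_Ioi_rpow_of_lt (by linarith) hc0).const_mul b
    · filter_upwards [ae_restrict_mem measurableSet_Ioi] with x hx
      have : 0 < x := hc0.trans hx
      simp only [Pi.zero_apply]
      positivity
  calc ∫⁻ x, min (ENNReal.ofReal (b * x ^ (-(1 / ρ)))) (ENNReal.ofReal t) ∂unitUniform
      ≤ ∫⁻ x in Set.Ioc 0 c ∪ Set.Ioi c,
          min (ENNReal.ofReal (b * x ^ (-(1 / ρ)))) (ENNReal.ofReal t) := by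
        refine lintegral_mono_set ?_
        rw [Set.Ioc_union_Ioi_eq_Ioi hc0.le]
        exact Set.Ioc_subset_Ioi_self
    _ ≤ _ := lintegral_union_le _ _ _
    _ ≤ (∫⁻ x in Set.Ioc 0 c, ENNReal.ofReal t)
          + ∫⁻ x in Set.Ioi c, ENNReal.ofReal (b * x ^ (-(1 / ρ))) := by
        gcongr with x x
        · exact min_le_right _ _
        · exact min_le_left _ _
    _ = _ := by
        rw [hI, setLIntegral_const, Real.volume_Ioc, sub_zero, ← ENNReal.ofReal_mul ht.le, h1,
          ← ENNReal.ofReal_add (by positivity)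
            (mul_nonneg (one_div_nonneg.2 (by linarith)) (by positivity))]
        congr 1
        ring

/-- Dyadic decomposition: if `2 ^ n ≤ y < 2 ^ (n+1)`, the `n`-th term alone is `2 ^ (α (n+1))`,
which exceeds `y ^ α`. It trades a power for truncations, which are subadditive. -/
theorem rpow_le_one_add_tsum_min {α : ℝ} (hα : 0 < α) {y : ℝ≥0∞} (hy : y ≠ ∞) :
    y ^ α ≤ 1 + ∑' n : ℕ, ENNReal.ofReal (2 ^ (α * (n + 1) - n)) * min y (ENNReal.ofReal (2 ^ n)) := by
  rcases le_total y 1 with h | h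
  · exact le_add_right (ENNReal.rpow_le_one h hα.le)
  lift y to NNReal using hy
  have h' : (1 : ℝ) ≤ y := by exact_mod_cast h
  obtain ⟨n, hn1, hn2⟩ := exists_nat_pow_near h' one_lt_two
  refine le_add_left (le_trans ?_ (ENNReal.le_tsum n))
  have e1 : (y : ℝ≥0∞) = ENNReal.ofReal (y : ℝ) := by simp
  rw [e1, min_eq_right (ENNReal.ofReal_le_ofReal hn1),
    ENNReal.ofReal_rpow_of_nonneg (by positivity) hα.le, ← ENNReal.ofReal_mul (by positivity)]
  refine ENNReal.ofReal_le_ofReal ?_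
  rw [Real.rpow_sub two_pos, Real.rpow_natCast, div_mul_cancel₀ _ (by positivity), mul_comm α,
    Real.rpow_mul two_pos.le]
  refine Real.rpow_le_rpow (by positivity) ?_ hα.le
  exact_mod_cast hn2.le

theorem min_sum_le_sum_min {ι : Type*} (s : Finset ι) (Z : ι → ℝ≥0∞) (t : ℝ≥0∞) :
    min (∑ k ∈ s, Z k) t ≤ ∑ k ∈ s, min (Z k) t := by
  classical
  induction s using Finset.induction_on with
  | empty => simp
  | insert k s hk ih =>
    rw [Finset.sum_insert hk, Finset.sum_insert hk]
    refine le_trans ?_ (add_le_add_right ih _)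
    rcases le_total (Z k) t with h | h
    · rw [min_eq_left h]
      rcases le_total (∑ k ∈ s, Z k) t with h' | h'
      · rw [min_eq_left h']
        exact min_le_left _ _
      · rw [min_eq_right h']
        exact (min_le_right _ _).trans le_add_self
    · rw [min_eq_right h]
      exact (min_le_right _ _).trans le_self_add

/-- The summands have infinite mean. Truncated at `2 ^ n`, their means add up to at most `C · 2 ^ (n
(1 - r/2))` since `∑ |aₖ| ^ r = 1`, and the dyadic weights make the series over `n` converge. -/
theorem lintegral_uniform_sum_rpow_le {r q : ℝ} (hq : 0 < q) (hqr : q < r) (hr2 : r < 2) :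
    ∃ K : ℝ≥0∞, K ≠ ∞ ∧ ∀ (ι : Type w) [Fintype ι] (a : ι → ℝ), ∑ k, ‖a k‖ₑ ^ r = 1 →
      ∫⁻ x, (∑ k, ‖a k * x k ^ (-1 / r)‖ₑ ^ (2 : ℝ)) ^ (q / 2)
        ∂(Measure.pi fun _ : ι => unitUniform) ≤ K := by
  have hr : 0 < r := hq.trans hqr
  set ρ := r / 2 with hρ
  have hρ0 : 0 < ρ := by positivity
  have hρ1 : ρ < 1 := by rw [hρ]; linarith
  set C := 1 + 1 / (1 / ρ - 1) with hC
  have hC0 : 0 ≤ C := by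
    have : 0 < 1 / ρ - 1 := by rw [sub_pos, one_lt_div hρ0]; exact hρ1
    positivity
  have hα : 0 < q / 2 := by positivity
  refine ⟨1 + ∑' n : ℕ, ENNReal.ofReal (2 ^ ((q / 2) * (n + 1) - n)) *
    ENNReal.ofReal (C * (2 ^ n) ^ (1 - ρ)), ?_, fun ι _ a ha => ?_⟩
  · refine ENNReal.add_ne_top.2 ⟨ENNReal.one_ne_top, ?_⟩
    have h1 : ∀ n : ℕ, ENNReal.ofReal (2 ^ ((q / 2) * (n + 1) - n)) *
        ENNReal.ofReal (C * (2 ^ n) ^ (1 - ρ))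
        = ENNReal.ofReal (2 ^ (q / 2) * C) * ENNReal.ofReal (2 ^ (q / 2 - ρ)) ^ n := by
      intro n
      rw [← ENNReal.ofReal_pow (by positivity), ← ENNReal.ofReal_mul (by positivity),
        ← ENNReal.ofReal_mul (by positivity)]
      congr 1
      rw [← Real.rpow_natCast 2 n, ← Real.rpow_natCast (2 ^ (q / 2 - ρ)) n, ← Real.rpow_mul two_pos.le,
        ← Real.rpow_mul two_pos.le, mul_left_comm, mul_comm _ C, mul_assoc,
        ← Real.rpow_add two_pos, ← Real.rpow_add two_pos]
      ring_nf
    simp_rw [h1]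
    rw [ENNReal.tsum_mul_left]
    refine ENNReal.mul_ne_top ENNReal.ofReal_ne_top ?_
    rw [ENNReal.tsum_geometric]
    refine ENNReal.inv_ne_top.2 ?_
    refine (tsub_pos_of_lt ?_).ne'
    rw [ENNReal.ofReal_lt_one]
    -- The ratio of the geometric series is `2 ^ ((q - r) / 2)`; this is where `q < r` is used.
    refine Real.rpow_lt_one_of_one_lt_of_neg one_lt_two ?_
    rw [hρ]
    linarith
  · have hZ : ∀ k (t : ℝ), 0 < t → ∫⁻ x : ι → ℝ, min (‖a k * x k ^ (-1 / r)‖ₑ ^ (2 : ℝ))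
        (ENNReal.ofReal t) ∂(Measure.pi fun _ : ι => unitUniform)
        ≤ ENNReal.ofReal (C * t ^ (1 - ρ)) * ‖a k‖ₑ ^ r := by
      intro k t ht
      rw [(measurePreserving_eval (fun _ : ι => unitUniform) k).lintegral_comp
        (f := fun y : ℝ => min (‖a k * y ^ (-1 / r)‖ₑ ^ (2 : ℝ)) (ENNReal.ofReal t)) (by fun_prop)]
      rcases eq_or_ne (a k) 0 with h0 | h0
      · simp [h0]
      have h1 : ∫⁻ y, min (‖a k * y ^ (-1 / r)‖ₑ ^ (2 : ℝ)) (ENNReal.ofReal t) ∂unitUniform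
          = ∫⁻ y, min (ENNReal.ofReal (a k ^ 2 * y ^ (-(1 / ρ)))) (ENNReal.ofReal t)
            ∂unitUniform := by
        refine lintegral_congr_ae ?_
        filter_upwards [ae_restrict_mem (μ := volume) measurableSet_Ioc] with y hy
        rw [enorm_rpow_eq_ofReal zero_le_two, Real.rpow_two, sq_abs, mul_pow,
          ← Real.rpow_natCast (y ^ (-1 / r)) 2, ← Real.rpow_mul hy.1.le]
        congr 5
        rw [hρ]
        push_cast
        field_simp
      rw [h1]
      refine (lintegral_min_uniform_le hρ0 hρ1 (by positivity) ht).trans_eq ?_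
      rw [enorm_rpow_eq_ofReal hr.le, ← ENNReal.ofReal_mul (by positivity), ← sq_abs (a k),
        ← Real.rpow_natCast |a k| 2, ← Real.rpow_mul (abs_nonneg _)]
      congr 1
      rw [hρ, hC]
      push_cast
      rw [mul_div_cancel₀ _ two_ne_zero]
      ring
    calc ∫⁻ x, (∑ k, ‖a k * x k ^ (-1 / r)‖ₑ ^ (2 : ℝ)) ^ (q / 2)
          ∂(Measure.pi fun _ : ι => unitUniform)
        ≤ ∫⁻ x, (1 + ∑' n : ℕ, ENNReal.ofReal (2 ^ ((q / 2) * (n + 1) - n)) *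
            ∑ k, min (‖a k * x k ^ (-1 / r)‖ₑ ^ (2 : ℝ)) (ENNReal.ofReal (2 ^ n)))
          ∂(Measure.pi fun _ : ι => unitUniform) := by
          refine lintegral_mono fun x => (rpow_le_one_add_tsum_min hα ?_).trans ?_
          · exact ENNReal.sum_ne_top.2 fun k _ => by finiteness
          · gcongr
            exact min_sum_le_sum_min _ _ _
      _ = 1 + ∑' n : ℕ, ENNReal.ofReal (2 ^ ((q / 2) * (n + 1) - n)) *
            ∑ k, ∫⁻ x, min (‖a k * x k ^ (-1 / r)‖ₑ ^ (2 : ℝ)) (ENNReal.ofReal (2 ^ n))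
          ∂(Measure.pi fun _ : ι => unitUniform) := by
          rw [lintegral_add_left (by fun_prop), lintegral_tsum fun n => Measurable.aemeasurable (by fun_prop)]
          simp only [lintegral_const, measure_univ, mul_one]
          congr 2
          ext n
          rw [lintegral_const_mul' _ _ ENNReal.ofReal_ne_top,
            lintegral_finsetSum _ fun k _ => by fun_prop]
      _ ≤ _ := by
          gcongr with n
          refine (Finset.sum_le_sum fun k _ => hZ k (2 ^ n) (by positivity)).trans_eq ?_
          rw [← Finset.mul_sum, ha, mul_one]

/-! ### Random families: one factor, then products -/

open ProbabilityTheory in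
/-- Independent products of a standard gaussian and a heavy-tailed variable imitate `r`-stable
variables: linear combinations have their `q`-th moments controlled by the `ℓ^r`-norm of the
coefficients, and are of the order of the `ℓ^r`-norm with a fixed positive probability. -/
theorem exists_random_family {r q : ℝ} (hr : 0 < r) (hq : 0 < q)
    (h : (r < 2 ∧ q < r) ∨ r = 2) :
    ∃ θ K : ℝ≥0∞, θ ≠ 0 ∧ K ≠ ∞ ∧ ∀ (ι : Type w) [Fintype ι],
      ∃ (A : Type w) (_ : MeasurableSpace A) (P : Measure A) (_ : IsProbabilityMeasure P)
        (X : ι → A → ℝ), (∀ k, Measurable (X k)) ∧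
        (∀ a : ι → ℝ, θ * ∑ k, ‖a k‖ₑ ^ r ≤
          ∫⁻ ω, min (‖∑ k, a k * X k ω‖ₑ ^ r) (∑ k, ‖a k‖ₑ ^ r) ∂P) ∧
        (∀ a : ι → ℝ, ∫⁻ ω, ‖∑ k, a k * X k ω‖ₑ ^ q ∂P ≤ K * (∑ k, ‖a k‖ₑ ^ r) ^ (q / r)) := by
  obtain ⟨K, hK, hKq⟩ := lintegral_gaussian_sum_rpow_le.{w} hq
  rcases h with ⟨hr2, hqr⟩ | rfl
  · obtain ⟨K', hK', hKq'⟩ := lintegral_uniform_sum_rpow_le.{w} hq hqr hr2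
    set κ := 1 - Real.exp (-1 / 2) with hκ
    have hκ0 : 0 < κ := by
      rw [hκ, sub_pos, Real.exp_lt_one_iff]
      norm_num
    refine ⟨ENNReal.ofReal ((1 - Real.exp (-κ)) / 2), K * K', ?_, by finiteness,
      fun ι _ => ⟨(ι → ℝ) × (ι → ℝ), inferInstance,
      (Measure.pi fun _ => gaussianReal 0 1).prod (Measure.pi fun _ => unitUniform),
      inferInstance, fun k ω => ω.1 k * ω.2 k ^ (-1 / r), fun k => by fun_prop, ?_, ?_⟩⟩
    · have : Real.exp (-κ) < 1 := by rw [Real.exp_lt_one_iff]; linarith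
      rw [Ne, ENNReal.ofReal_eq_zero, not_le]
      linarith
    · refine lower_bound_of_normalized hr fun a ha => ?_
      refine le_trans (ENNReal.ofReal_le_ofReal ?_)
        (ofReal_half_one_sub_cos_le_lintegral_min hr hr2.le (by fun_prop))
      have ha' : ∑ k, |a k| ^ r = 1 := by
        rwa [sum_enorm_rpow_eq_ofReal hr.le, ENNReal.ofReal_eq_one] at ha
      have ha1 : ∀ k, |a k| ≤ 1 := by
        intro k
        have h1 : |a k| ^ r ≤ 1 := ha' ▸ Finset.single_le_sum (f := fun k => |a k| ^ r)
          (fun k _ => by positivity) (Finset.mem_univ k)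
        by_contra! h2
        exact absurd h1 (not_le.2 (Real.one_lt_rpow h2 hr))
      have hint : Integrable (fun ω : (ι → ℝ) × (ι → ℝ) =>
          Real.cos (∑ k, a k * (ω.1 k * ω.2 k ^ (-1 / r))))
          ((Measure.pi fun _ => gaussianReal 0 1).prod (Measure.pi fun _ => unitUniform)) :=
        Integrable.of_bound (C := 1) (Measurable.aestronglyMeasurable (by fun_prop))
          (Filter.Eventually.of_forall fun g => Real.abs_cos_le_one _)
      have key : ∫ ω : (ι → ℝ) × (ι → ℝ), Real.cos (∑ k, a k * (ω.1 k * ω.2 k ^ (-1 / r)))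
          ∂((Measure.pi fun _ => gaussianReal 0 1).prod (Measure.pi fun _ => unitUniform))
          ≤ Real.exp (-κ) := by
        -- Conditionally on the uniform variables the sum is gaussian; its characteristic function
        -- is a product over `k`, which the remaining integral factors through.
        rw [integral_prod_symm _ hint]
        have h1 : ∀ x : ι → ℝ, ∫ g : ι → ℝ, Real.cos (∑ k, a k * (g k * x k ^ (-1 / r)))
            ∂(Measure.pi fun _ => gaussianReal 0 1)
            = ∏ k, Real.exp (-(a k * x k ^ (-1 / r)) ^ 2 / 2) := by
          intro x
          rw [← Real.exp_sum, ← Finset.sum_div, Finset.sum_neg_distrib,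
            ← integral_cos_sum_gaussian fun k => a k * x k ^ (-1 / r)]
          refine integral_congr_ae (Filter.Eventually.of_forall fun g => ?_)
          simp only
          congr 1
          exact Finset.sum_congr rfl fun k _ => by ring
        simp only [h1]
        rw [integral_fintype_prod_eq_prod (𝕜 := ℝ)
          (f := fun k (y : ℝ) => Real.exp (-(a k * y ^ (-1 / r)) ^ 2 / 2))]
        refine (Finset.prod_le_prod (fun k _ => integral_nonneg fun y => (Real.exp_pos _).le)
          fun k _ => integral_exp_neg_sq_uniform_le hr (ha1 k)).trans_eq ?_
        rw [← Real.exp_sum, Finset.sum_neg_distrib, ← Finset.mul_sum, ha', mul_one]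
      linarith
    · refine upper_bound_of_normalized hr hq fun a ha => ?_
      -- The gaussian variables are integrated first, leaving the `q/2`-th moment of the conditional
      -- variance.
      rw [lintegral_prod_symm' _ (by fun_prop)]
      calc ∫⁻ x, ∫⁻ g, ‖∑ k, a k * (g k * x k ^ (-1 / r))‖ₑ ^ q
            ∂(Measure.pi fun _ : ι => gaussianReal 0 1) ∂(Measure.pi fun _ : ι => unitUniform)
          ≤ ∫⁻ x, K * (∑ k, ‖a k * x k ^ (-1 / r)‖ₑ ^ (2 : ℝ)) ^ (q / 2)
            ∂(Measure.pi fun _ : ι => unitUniform) := by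
            refine lintegral_mono fun x => ?_
            refine le_trans (le_of_eq ?_) (hKq ι fun k => a k * x k ^ (-1 / r))
            refine lintegral_congr fun g => ?_
            congr 2
            exact Finset.sum_congr rfl fun k _ => by ring
        _ ≤ K * K' := by
            rw [lintegral_const_mul' _ _ hK]
            gcongr
            exact hKq' ι a ha
  -- For `r = 2` gaussians alone suffice; they have all moments, so `q` is not restricted.
  · refine ⟨ENNReal.ofReal ((1 - Real.exp (-1 / 2)) / 2), K, ?_, hK,
      fun ι _ => ⟨ι → ℝ, inferInstance, Measure.pi fun _ => gaussianReal 0 1,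
      inferInstance, fun k ω => ω k, fun k => by fun_prop, ?_, hKq ι⟩⟩
    · have : Real.exp (-1 / 2) < 1 := by rw [Real.exp_lt_one_iff]; norm_num
      rw [Ne, ENNReal.ofReal_eq_zero, not_le]
      linarith
    · refine lower_bound_of_normalized hr fun a ha => ?_
      refine le_trans (le_of_eq ?_)
        (ofReal_half_one_sub_cos_le_lintegral_min hr le_rfl (by fun_prop))
      have ha2 : ∑ k, a k ^ 2 = 1 := by
        rw [sum_enorm_rpow_eq_ofReal zero_le_two, ENNReal.ofReal_eq_one] at ha
        simpa using ha
      rw [integral_cos_sum_gaussian, ha2]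

/-- Changes the truncation level, by `min Y L ≥ (L/B) min Y B` when `L ≤ B`. In the product
construction the natural level `B` depends on the other variables, while `L` must be fixed. -/
theorem le_lintegral_min_of_le_lintegral_min {A : Type*} [MeasurableSpace A] {P : Measure A}
    [IsProbabilityMeasure P] {Y : A → ℝ≥0∞} {θ B L : ℝ≥0∞} (hB : B ≠ ∞)
    (h : θ * B ≤ ∫⁻ ω, min (Y ω) B ∂P) : θ * min B L ≤ ∫⁻ ω, min (Y ω) L ∂P := by
  rcases le_total B L with hBL | hBL
  · rw [min_eq_left hBL]
    exact h.trans (lintegral_mono fun ω => min_le_min_left _ hBL)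
  · rw [min_eq_right hBL]
    rcases eq_or_ne B 0 with rfl | hB0
    · simp [nonpos_iff_eq_zero.1 hBL]
    have hc : L / B ≤ 1 := ENNReal.div_le_of_le_mul (by simpa using hBL)
    have hcB : L / B * B = L := ENNReal.div_mul_cancel hB0 hB
    calc θ * L = L / B * (θ * B) := by rw [mul_left_comm, hcB]
      _ ≤ L / B * ∫⁻ ω, min (Y ω) B ∂P := by gcongr
      _ = ∫⁻ ω, L / B * min (Y ω) B ∂P :=
        (lintegral_const_mul' _ _ (ne_top_of_le_ne_top ENNReal.one_ne_top hc)).symm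
      _ ≤ _ := by
        refine lintegral_mono fun ω => le_min ?_ ?_
        · calc L / B * min (Y ω) B ≤ 1 * Y ω := by
                gcongr
                exact min_le_left _ _
            _ = Y ω := one_mul _
        · calc L / B * min (Y ω) B ≤ L / B * B := by
                gcongr
                exact min_le_right _ _
            _ = L := hcB

theorem sum_min_le_min_sum {ι : Type*} (s : Finset ι) (Y Z : ι → ℝ≥0∞) :
    ∑ k ∈ s, min (Y k) (Z k) ≤ min (∑ k ∈ s, Y k) (∑ k ∈ s, Z k) :=
  le_min (Finset.sum_le_sum fun _ _ => min_le_left _ _)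
    (Finset.sum_le_sum fun _ _ => min_le_right _ _)

theorem sum_pi_fin_succ {M : Type*} [AddCommMonoid M] {m : ℕ} {κ : Fin (m + 1) → Type w}
    [∀ i, Fintype (κ i)] (F : (∀ i, κ i) → M) :
    ∑ k, F k = ∑ k₀ : κ 0, ∑ k' : ∀ i : Fin m, κ i.succ, F (Fin.cons k₀ k') := by
  rw [← Fintype.sum_prod_type']
  exact (Equiv.sum_comp (Fin.consEquiv κ) F).symm

theorem exists_random_families (m : ℕ) {r : ℝ} (q : Fin m → ℝ) (hr : 0 < r) (hq : ∀ i, 0 < q i)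
    (h : (r < 2 ∧ ∀ i, q i < r) ∨ r = 2) :
    ∃ (θ : ℝ≥0∞) (K : Fin m → ℝ≥0∞), θ ≠ 0 ∧ (∀ i, K i ≠ ∞) ∧
      ∀ (κ : Fin m → Type w) [∀ i, Fintype (κ i)],
      ∃ (A : Type w) (_ : MeasurableSpace A) (P : Measure A) (_ : IsProbabilityMeasure P)
        (X : ∀ i, κ i → A → ℝ), (∀ i k, Measurable (X i k)) ∧
        (∀ a : (∀ i, κ i) → ℝ, θ * ∑ k, ‖a k‖ₑ ^ r ≤
          ∫⁻ ω, min (‖∑ k, a k * ∏ i, X i (k i) ω‖ₑ ^ r) (∑ k, ‖a k‖ₑ ^ r) ∂P) ∧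
        (∀ i (a : κ i → ℝ), ∫⁻ ω, ‖∑ k, a k * X i k ω‖ₑ ^ q i ∂P
          ≤ K i * (∑ k, ‖a k‖ₑ ^ r) ^ (q i / r)) := by
  induction m with
  | zero =>
    refine ⟨1, fun _ => 0, one_ne_zero, fun i => i.elim0, fun κ _ => ⟨PUnit, inferInstance,
      Measure.dirac PUnit.unit, inferInstance, fun i => i.elim0, fun i => i.elim0, fun a => ?_,
      fun i => i.elim0⟩⟩
    simp
  | succ m ih =>
    obtain ⟨θ', K', hθ', hK', H'⟩ := ih (fun i => q i.succ) (fun i => hq _)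
      (h.imp_left fun h => ⟨h.1, fun i => h.2 _⟩)
    obtain ⟨θ, K, hθ, hK, H⟩ := exists_random_family.{w} hr (hq 0)
      (h.imp_left fun h => ⟨h.1, h.2 0⟩)
    refine ⟨θ * θ', Fin.cons K K', mul_ne_zero hθ hθ', fun i => ?_, fun κ _ => ?_⟩
    · refine Fin.cases ?_ (fun i => ?_) i
      · simpa using hK
      · simpa using hK' i
    obtain ⟨A', _, P', _, X', hX', hL', hU'⟩ := H' fun i => κ i.succ
    obtain ⟨A, _, P, _, X, hX, hL, hU⟩ := H (κ 0)
    refine ⟨A × A', inferInstance, P.prod P', inferInstance,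
      Fin.cons (α := fun i => κ i → A × A' → ℝ) (fun k ω => X k ω.1) (fun i k ω => X' i k ω.2),
      fun i => ?_, fun a => ?_, fun i => ?_⟩
    · refine Fin.cases (fun k => ?_) (fun i k => ?_) i
      · exact (hX k).comp measurable_fst
      · exact (hX' i k).comp measurable_snd
    · simp_rw [Fin.prod_univ_succ, Fin.cons_zero, Fin.cons_succ]
      set L := ∑ k, ‖a k‖ₑ ^ r with hLdef
      set b : κ 0 → A' → ℝ := fun k₀ ω => ∑ k' : ∀ i : Fin m, κ i.succ,
        a (Fin.cons k₀ k') * ∏ i, X' i (k' i) ω with hb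
      have hsum : ∀ ω : A × A', ∑ k : ∀ i, κ i, a k * (X (k 0) ω.1 * ∏ i, X' i (k i.succ) ω.2)
          = ∑ k₀, b k₀ ω.2 * X k₀ ω.1 := by
        intro ω
        rw [sum_pi_fin_succ]
        refine Finset.sum_congr rfl fun k₀ _ => ?_
        rw [hb, Finset.sum_mul]
        refine Finset.sum_congr rfl fun k' _ => ?_
        simp only [Fin.cons_zero, Fin.cons_succ]
        ring
      have hbm : ∀ k₀, Measurable (b k₀) := by
        intro k₀
        refine Finset.measurable_sum _ fun k' _ => Measurable.const_mul ?_ _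
        exact Finset.measurable_prod _ fun i _ => hX' _ _
      simp_rw [hsum]
      rw [lintegral_prod_symm' _ (by fun_prop)]
      -- The inductive hypothesis bounds each random coefficient `b k₀` from below, and truncations
      -- are summed over `k₀`. Then, with the variables of `A'` frozen, the single family is applied
      -- to the coefficients `b k₀ ω`, at the fixed level `L`.
      calc θ * θ' * L
          ≤ θ * ∫⁻ ω, min (∑ k₀, ‖b k₀ ω‖ₑ ^ r) L ∂P' := by
            rw [mul_assoc]
            gcongr
            rw [hLdef, sum_pi_fin_succ]
            calc θ' * ∑ k₀, ∑ k' : ∀ i : Fin m, κ i.succ, ‖a (Fin.cons k₀ k')‖ₑ ^ r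
                ≤ ∑ k₀, ∫⁻ ω, min (‖b k₀ ω‖ₑ ^ r)
                    (∑ k' : ∀ i : Fin m, κ i.succ, ‖a (Fin.cons k₀ k')‖ₑ ^ r) ∂P' := by
                  rw [Finset.mul_sum]
                  exact Finset.sum_le_sum fun k₀ _ => hL' fun k' => a (Fin.cons k₀ k')
              _ = ∫⁻ ω, ∑ k₀, min (‖b k₀ ω‖ₑ ^ r)
                    (∑ k' : ∀ i : Fin m, κ i.succ, ‖a (Fin.cons k₀ k')‖ₑ ^ r) ∂P' :=
                  (lintegral_finsetSum _ fun k₀ _ => by fun_prop).symm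
              _ ≤ _ := lintegral_mono fun ω => sum_min_le_min_sum _ _ _
        _ = ∫⁻ ω, θ * min (∑ k₀, ‖b k₀ ω‖ₑ ^ r) L ∂P' :=
            (lintegral_const_mul _ (by fun_prop)).symm
        _ ≤ _ := lintegral_mono fun ω =>
            le_lintegral_min_of_le_lintegral_min
              (ENNReal.sum_ne_top.2 fun k _ => ENNReal.rpow_ne_top_of_nonneg hr.le enorm_ne_top)
              (hL fun k₀ => b k₀ ω)
    · refine Fin.cases (fun a => ?_) (fun i a => ?_) i
      · simp only [Fin.cons_zero]
        rw [lintegral_prod_symm' _ (by fun_prop)]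
        simpa using hU a
      · simp only [Fin.cons_succ]
        rw [lintegral_prod _ (Measurable.aemeasurable (by fun_prop))]
        simpa using hU' i a

/-! ### Transfer from single functions to finite families -/

/-- Markov's inequality; with a strict inequality inside the event it also covers `Z = 0`, where `H`
vanishes almost everywhere. -/
theorem measure_div_lt_le_of_lintegral_le {A : Type*} [MeasurableSpace A] {P : Measure A}
    {H : A → ℝ≥0∞} (hH : Measurable H) {Z η : ℝ≥0∞} (hη : η ≠ 0) (hη' : η ≠ ∞)
    (h : ∫⁻ ω, H ω ∂P ≤ Z) : P {ω | Z / η < H ω} ≤ η := by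
  rcases eq_or_ne Z ∞ with rfl | hZ
  · simp [ENNReal.top_div_of_ne_top hη']
  rcases eq_or_ne Z 0 with rfl | hZ0
  · have h0 := (lintegral_eq_zero_iff hH).1 (nonpos_iff_eq_zero.1 h)
    have : P {ω | 0 / η < H ω} = 0 := by
      refine measure_mono_null (fun ω hω => ?_) (ae_iff.1 h0)
      simp only [Set.mem_ofPred_eq, ENNReal.zero_div] at hω
      exact hω.ne'
    rw [this]
    exact zero_le
  · have hd : Z / η ≠ 0 := ENNReal.div_ne_zero.2 ⟨hZ0, hη'⟩
    have hd' : Z / η ≠ ∞ := ENNReal.div_ne_top hZ hη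
    calc P {ω | Z / η < H ω} ≤ P {ω | Z / η ≤ H ω} := measure_mono fun ω hω => by
          simp only [Set.mem_ofPred_eq] at hω ⊢
          exact hω.le
      _ ≤ (∫⁻ ω, H ω ∂P) / (Z / η) := meas_ge_le_lintegral_div hH.aemeasurable hd hd'
      _ ≤ Z / (Z / η) := by gcongr
      _ = η := ENNReal.div_div_cancel hZ0 hZ

/-- A Paley–Zygmund argument in which truncation replaces the second moment: `∫ min Y L ≤ 2τL + L ·
P(Y ≥ 2τL)` forces `P(Y ≥ 2τL) ≥ 2τ`, and discarding `Gᶜ` costs at most `τ`. -/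
theorem le_measure_inter_of_le_lintegral_min {A : Type*} [MeasurableSpace A] {P : Measure A}
    [IsProbabilityMeasure P] {Y : A → ℝ≥0∞} (hY : Measurable Y) {τ L : ℝ≥0∞} (hτ : 4 * τ ≤ 1)
    (hL : L ≠ ∞) (h : 4 * τ * L ≤ ∫⁻ ω, min (Y ω) L ∂P) {G : Set A} (hG : P Gᶜ ≤ τ) :
    τ ≤ P (G ∩ {ω | 2 * τ * L ≤ Y ω}) := by
  have h4 : 4 * τ = 2 * τ + 2 * τ := by ring
  have hτ' : τ ≠ ∞ := by
    rintro rfl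
    simp at hτ
  have hE : 2 * τ ≤ P {ω | 2 * τ * L ≤ Y ω} := by
    rcases eq_or_ne L 0 with rfl | hL0
    · simp only [mul_zero, zero_le, Set.ofPred_true, measure_univ]
      exact le_trans (h4 ▸ le_self_add) hτ
    have hm : MeasurableSet {ω | 2 * τ * L ≤ Y ω} := measurableSet_le measurable_const hY
    have h1 : ∫⁻ ω, min (Y ω) L ∂P ≤ 2 * τ * L + L * P {ω | 2 * τ * L ≤ Y ω} := by
      calc ∫⁻ ω, min (Y ω) L ∂P
          ≤ ∫⁻ ω, (2 * τ * L + {ω | 2 * τ * L ≤ Y ω}.indicator (fun _ => L) ω) ∂P := by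
            refine lintegral_mono fun ω => ?_
            by_cases hω : ω ∈ {ω | 2 * τ * L ≤ Y ω}
            · rw [Set.indicator_of_mem hω]
              exact (min_le_right _ _).trans le_add_self
            · rw [Set.indicator_of_notMem hω, add_zero]
              exact (min_le_left _ _).trans (le_of_lt (not_le.1 hω))
        _ = _ := by
            rw [lintegral_add_left measurable_const, lintegral_indicator_const hm]
            simp
    have h2 : 2 * τ * L + 2 * τ * L ≤ 2 * τ * L + L * P {ω | 2 * τ * L ≤ Y ω} := by
      rw [← add_mul, ← h4]
      exact h.trans h1
    have h3 := (ENNReal.add_le_add_iff_left (by finiteness)).1 h2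
    rw [mul_comm L] at h3
    exact (ENNReal.mul_le_mul_iff_left hL0 hL).1 h3
  have h5 : P {ω | 2 * τ * L ≤ Y ω} ≤ P (G ∩ {ω | 2 * τ * L ≤ Y ω}) + τ := by
    calc P {ω | 2 * τ * L ≤ Y ω} ≤ P ((G ∩ {ω | 2 * τ * L ≤ Y ω}) ∪ Gᶜ) := by
          refine measure_mono fun ω hω => ?_
          by_cases hωG : ω ∈ G
          · exact Or.inl ⟨hωG, hω⟩
          · exact Or.inr hωG
      _ ≤ _ := measure_union_le _ _
      _ ≤ _ := by gcongr
  have h6 : τ + τ ≤ P (G ∩ {ω | 2 * τ * L ≤ Y ω}) + τ := by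
    rw [← two_mul]
    exact hE.trans h5
  exact (ENNReal.add_le_add_iff_right hτ').1 h6

theorem eLpNorm_ofReal_eq {Ω ε : Type*} [MeasurableSpace Ω] [ENorm ε] {μ : Measure Ω} {q : ℝ}
    (hq : 0 < q) (f : Ω → ε) :
    eLpNorm f (ENNReal.ofReal q) μ = (∫⁻ x, ‖f x‖ₑ ^ q ∂μ) ^ (1 / q) := by
  rw [eLpNorm_eq_lintegral_rpow_enorm_toReal (by simpa using hq) ENNReal.ofReal_ne_top,
    ENNReal.toReal_ofReal hq.le]

theorem eLpNorm_ofReal_rpow {Ω ε : Type*} [MeasurableSpace Ω] [ENorm ε] {μ : Measure Ω} {q : ℝ}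
    (hq : 0 < q) (f : Ω → ε) :
    eLpNorm f (ENNReal.ofReal q) μ ^ q = ∫⁻ x, ‖f x‖ₑ ^ q ∂μ := by
  rw [eLpNorm_ofReal_eq hq, ← ENNReal.rpow_mul, one_div_mul_cancel hq.ne', ENNReal.rpow_one]

/-- The average over a random family of the `q`-th powers of `L^q`-norms of random linear
combinations. -/
theorem lintegral_lintegral_sum_le {A Ω κ : Type*} [MeasurableSpace A] [MeasurableSpace Ω]
    [Fintype κ] {P : Measure A} [SFinite P] {μ : Measure Ω} [SFinite μ] {X : κ → A → ℝ}
    (hX : ∀ k, Measurable (X k)) {r q : ℝ} (hq : 0 < q) {K : ℝ≥0∞} (hK : K ≠ ∞)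
    (hU : ∀ a : κ → ℝ, ∫⁻ ω, ‖∑ k, a k * X k ω‖ₑ ^ q ∂P ≤ K * (∑ k, ‖a k‖ₑ ^ r) ^ (q / r))
    {f : κ → Ω → ℝ} (hf : ∀ k, Measurable (f k)) :
    ∫⁻ ω, ∫⁻ x, ‖∑ k, f k x * X k ω‖ₑ ^ q ∂μ ∂P
      ≤ K * eLpNorm (lrNorm r f) (ENNReal.ofReal q) μ ^ q := by
  rw [lintegral_lintegral_swap (Measurable.aemeasurable (by fun_prop)), eLpNorm_ofReal_rpow hq,
    ← lintegral_const_mul' _ _ hK]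
  refine lintegral_mono fun x => (hU fun k => f k x).trans_eq ?_
  rw [lrNorm, tsum_fintype, enorm_eq_self, ← ENNReal.rpow_mul, one_div_mul_eq_div]

theorem coeFn_multilinear_sum {m : ℕ} {E : Fin m → Type*} [∀ i, AddCommGroup (E i)]
    [∀ i, Module ℝ (E i)] {Ω' : Type*} [MeasurableSpace Ω'] {ν : Measure Ω'}
    (T : MultilinearMap ℝ E (Ω' →ₘ[ν] ℝ)) {κ : Fin m → Type*} [∀ i, Fintype (κ i)]
    (f : ∀ i, κ i → E i) (c : ∀ i, κ i → ℝ) :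
    (T fun i => ∑ k, c i k • f i k : Ω' → ℝ) =ᵐ[ν]
      fun y => ∑ k : ∀ i, κ i, (T fun i => f i (k i) : Ω' → ℝ) y * ∏ i, c i (k i) := by
  classical
  rw [T.map_sum]
  simp_rw [T.map_smul_univ]
  refine (AEEqFun.coeFn_finsetSum _ _).trans ?_
  have h : ∀ k : ∀ i, κ i, (((∏ i, c i (k i)) • T fun i => f i (k i) : Ω' →ₘ[ν] ℝ) : Ω' → ℝ)
      =ᵐ[ν] fun y => (T fun i => f i (k i) : Ω' → ℝ) y * ∏ i, c i (k i) := by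
    intro k
    filter_upwards [AEEqFun.coeFn_smul (∏ i, c i (k i)) (T fun i => f i (k i))] with y hy
    rw [hy, Pi.smul_apply, smul_eq_mul, mul_comm]
  filter_upwards [ae_all_iff.2 h] with y hy
  simp only [Finset.sum_apply]
  exact Finset.sum_congr rfl fun k _ => hy k

theorem coeFn_Lp_sum_smul {Ω κ : Type*} [MeasurableSpace Ω] {μ : Measure Ω} {q : ℝ≥0∞} [Fintype κ]
    (f : κ → Lp ℝ q μ) (c : κ → ℝ) :
    (∑ k, c k • f k : Lp ℝ q μ) =ᵐ[μ] fun x => ∑ k, (f k : Ω → ℝ) x * c k := by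
  refine (Lp.coeFn_finsetSum _ _).trans ?_
  have h : ∀ k, ((c k • f k : Lp ℝ q μ) : Ω → ℝ) =ᵐ[μ] fun x => (f k : Ω → ℝ) x * c k := by
    intro k
    filter_upwards [Lp.coeFn_smul (c k) (f k)] with y hy
    rw [hy, Pi.smul_apply, smul_eq_mul, mul_comm]
  filter_upwards [ae_all_iff.2 h] with y hy
  simp only [Finset.sum_apply]
  exact Finset.sum_congr rfl fun k _ => hy k

/-- Bounds for a multilinear operator on single functions transfer to finite families. -/
theorem exists_finite_transfer (m : ℕ) {r : ℝ} (q : Fin m → ℝ) (hr : 0 < r) (hq : ∀ i, 0 < q i)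
    (h : (r < 2 ∧ ∀ i, q i < r) ∨ r = 2) :
    ∃ (c τ : ℝ≥0∞) (M : Fin m → ℝ≥0∞), c ≠ 0 ∧ c ≠ ∞ ∧ τ ≠ 0 ∧ τ ≠ ∞ ∧ (∀ i, M i ≠ ∞) ∧
      ∀ (Ω : Fin m → Type u) [∀ i, MeasurableSpace (Ω i)]
        (μ : ∀ i, Measure (Ω i)) [∀ i, SigmaFinite (μ i)]
        (Ω' : Type v) [MeasurableSpace Ω'] (ν : Measure Ω') [SigmaFinite ν]
        (κ : Fin m → Type w) [∀ i, Fintype (κ i)]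
        (f : ∀ i, κ i → Lp ℝ (ENNReal.ofReal (q i)) (μ i))
        (T : MultilinearMap ℝ (fun i => Lp ℝ (ENNReal.ofReal (q i)) (μ i)) (Ω' →ₘ[ν] ℝ))
        (F : ℝ≥0∞ → ℝ≥0∞) (_ : Monotone F) (B : ℝ≥0∞)
        (_ : ∀ x : ∀ i, Lp ℝ (ENNReal.ofReal (q i)) (μ i),
          (∀ i, ‖x i‖ₑ ≤ M i * eLpNorm (lrNorm r fun k : κ i => (f i k : Ω i → ℝ))
            (ENNReal.ofReal (q i)) (μ i)) → ∫⁻ y, F ‖(T x : Ω' → ℝ) y‖ₑ ∂ν ≤ B),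
        τ * ∫⁻ y, F (c * lrNorm r (fun (k : ∀ i, κ i) => (T fun i => f i (k i) : Ω' → ℝ)) y) ∂ν
          ≤ B := by
  obtain ⟨θ, K, hθ, hK, H⟩ := exists_random_families.{w} m q hr hq h
  set τ := min θ 1 / 4 with hτdef
  have h4τ : 4 * τ = min θ 1 := ENNReal.mul_div_cancel (by norm_num) (by norm_num)
  have hτ1 : 4 * τ ≤ 1 := h4τ.trans_le (min_le_right _ _)
  have hτθ : 4 * τ ≤ θ := h4τ.trans_le (min_le_left _ _)
  have hτ0 : τ ≠ 0 := ENNReal.div_ne_zero.2 ⟨by simp [hθ], by norm_num⟩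
  have hτt : τ ≠ ∞ := by
    intro h
    simp [h] at hτ1
  -- The `m` exceptional sets have total probability at most `τ`; the `+ 1` keeps the quotient
  -- meaningful for `m = 0`.
  set η := τ / (m + 1) with hηdef
  have hη0 : η ≠ 0 := ENNReal.div_ne_zero.2 ⟨hτ0, by finiteness⟩
  have hηt : η ≠ ∞ := ENNReal.div_ne_top hτt (by simp)
  have hmη : m * η ≤ τ := by
    calc m * η ≤ (m + 1) * η := by
          gcongr
          exact le_self_add
      _ = τ := ENNReal.mul_div_cancel (by simp) (by finiteness)
  -- `c` is the `r`-th root of the factor in the threshold `2τL`, and `M i` is what Markov's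
  -- inequality with exceptional probability `η` leaves.
  refine ⟨(2 * τ) ^ (1 / r), τ, fun i => (K i / η) ^ (1 / q i), ?_, ?_, hτ0, hτt, fun i => ?_, ?_⟩
  · rw [Ne, ENNReal.rpow_eq_zero_iff_of_pos (by positivity)]
    exact mul_ne_zero two_ne_zero hτ0
  · exact ENNReal.rpow_ne_top_of_nonneg (by positivity) (by finiteness)
  · exact ENNReal.rpow_ne_top_of_nonneg (by have := hq i; positivity)
      (ENNReal.div_ne_top (hK i) hη0)
  intro Ω _ μ _ Ω' _ ν _ κ _ f T F hF B hB
  obtain ⟨A, _, P, _, X, hX, hL, hU⟩ := H κ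
  set N : Fin m → ℝ≥0∞ := fun i => eLpNorm (lrNorm r fun k : κ i => (f i k : Ω i → ℝ))
    (ENNReal.ofReal (q i)) (μ i) with hN
  have hfm : ∀ i k, Measurable (f i k : Ω i → ℝ) := fun i k => (Lp.stronglyMeasurable _).measurable
  set Hn : Fin m → A → ℝ≥0∞ := fun i ω => ∫⁻ x, ‖∑ k, (f i k : Ω i → ℝ) x * X i k ω‖ₑ ^ q i ∂(μ i)
    with hHn
  have hHm : ∀ i, Measurable (Hn i) := by
    intro i
    exact Measurable.lintegral_prod_right
      (f := fun ω x => ‖∑ k, (f i k : Ω i → ℝ) x * X i k ω‖ₑ ^ q i)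
      (by simp only [Function.uncurry_def]; fun_prop)
  have hHle : ∀ i, P {ω | K i * N i ^ q i / η < Hn i ω} ≤ η := fun i =>
    measure_div_lt_le_of_lintegral_le (hHm i) hη0 hηt
      (lintegral_lintegral_sum_le (hX i) (hq i) (hK i) (hU i) (hfm i))
  set G : Set A := ⋂ i, {ω | Hn i ω ≤ K i * N i ^ q i / η} with hG
  have hGm : MeasurableSet G := MeasurableSet.iInter fun i =>
    measurableSet_le (hHm i) measurable_const
  have hGc : P Gᶜ ≤ τ := by
    calc P Gᶜ = P (⋃ i, {ω | K i * N i ^ q i / η < Hn i ω}) := by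
          rw [hG, Set.compl_iInter]
          congr 1
          refine Set.iUnion_congr fun i => ?_
          ext ω
          simp
      _ ≤ ∑ i, P {ω | K i * N i ^ q i / η < Hn i ω} := measure_iUnion_fintype_le _ _
      _ ≤ ∑ _i : Fin m, η := Finset.sum_le_sum fun i _ => hHle i
      _ = m * η := by simp
      _ ≤ τ := hmη
  set g : (∀ i, κ i) → Ω' → ℝ := fun k => (T fun i => f i (k i) : Ω' →ₘ[ν] ℝ) with hg
  have hgm : ∀ k, Measurable (g k) := fun k => (AEEqFun.stronglyMeasurable _).measurable
  set S : A → Ω' → ℝ := fun ω y => ∑ k, g k y * ∏ i, X i (k i) ω with hS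
  have hSm : Measurable (Function.uncurry S) := by
    refine Finset.measurable_sum _ fun k _ => ((hgm k).comp measurable_snd).mul ?_
    exact Finset.measurable_prod _ fun i _ => (hX i _).comp measurable_fst
  have hcS : ∀ y ω, 2 * τ * ∑ k, ‖g k y‖ₑ ^ r ≤ ‖S ω y‖ₑ ^ r →
      (2 * τ) ^ (1 / r) * lrNorm r g y ≤ ‖S ω y‖ₑ := by
    intro y ω hω
    have := ENNReal.rpow_le_rpow hω (by positivity : 0 ≤ 1 / r)
    rw [← ENNReal.rpow_mul, mul_one_div_cancel hr.ne', ENNReal.rpow_one,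
      ENNReal.mul_rpow_of_nonneg _ _ (by positivity)] at this
    rwa [lrNorm, tsum_fintype]
  have hFm : Measurable F := hF.measurable
  have hpoint : ∀ y, τ * F ((2 * τ) ^ (1 / r) * lrNorm r g y) ≤ ∫⁻ ω in G, F ‖S ω y‖ₑ ∂P := by
    intro y
    have hSy : Measurable fun ω => S ω y := hSm.comp measurable_prodMk_right
    have h1 := le_measure_inter_of_le_lintegral_min (P := P) (Y := fun ω => ‖S ω y‖ₑ ^ r)
      (by fun_prop) hτ1
      (ENNReal.sum_ne_top.2 fun k _ => ENNReal.rpow_ne_top_of_nonneg hr.le enorm_ne_top)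
      ((mul_le_mul_left hτθ _).trans (hL fun k => g k y)) hGc
    have hEm : MeasurableSet {ω | 2 * τ * ∑ k, ‖g k y‖ₑ ^ r ≤ ‖S ω y‖ₑ ^ r} :=
      measurableSet_le measurable_const (by fun_prop)
    calc τ * F ((2 * τ) ^ (1 / r) * lrNorm r g y)
        ≤ F ((2 * τ) ^ (1 / r) * lrNorm r g y) *
            P (G ∩ {ω | 2 * τ * ∑ k, ‖g k y‖ₑ ^ r ≤ ‖S ω y‖ₑ ^ r}) := by
          rw [mul_comm]
          gcongr
      _ = ∫⁻ ω in G ∩ {ω | 2 * τ * ∑ k, ‖g k y‖ₑ ^ r ≤ ‖S ω y‖ₑ ^ r},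
            F ((2 * τ) ^ (1 / r) * lrNorm r g y) ∂P := (setLIntegral_const _ _).symm
      _ ≤ ∫⁻ ω in G ∩ {ω | 2 * τ * ∑ k, ‖g k y‖ₑ ^ r ≤ ‖S ω y‖ₑ ^ r}, F ‖S ω y‖ₑ ∂P := by
          refine setLIntegral_mono' (hGm.inter hEm) fun ω hω => hF (hcS y ω hω.2)
      _ ≤ _ := lintegral_mono_set Set.inter_subset_left
  calc τ * ∫⁻ y, F ((2 * τ) ^ (1 / r) * lrNorm r g y) ∂ν
      = ∫⁻ y, τ * F ((2 * τ) ^ (1 / r) * lrNorm r g y) ∂ν := (lintegral_const_mul' _ _ hτt).symm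
    _ ≤ ∫⁻ y, ∫⁻ ω in G, F ‖S ω y‖ₑ ∂P ∂ν := lintegral_mono hpoint
    -- After the swap, `ω ∈ G` is fixed and `S ω` is `T` at a single admissible tuple, so `hB`
    -- applies.
    _ = ∫⁻ ω in G, ∫⁻ y, F ‖S ω y‖ₑ ∂ν ∂P :=
        lintegral_lintegral_swap (Measurable.aemeasurable
          (hFm.comp ((hSm.comp measurable_swap).enorm)))
    _ ≤ ∫⁻ _ω in G, B ∂P := by
        refine setLIntegral_mono' hGm fun ω hω => ?_
        have hx := hB (fun i => ∑ k, X i k ω • f i k) fun i => ?_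
        · refine le_trans (le_of_eq (lintegral_congr_ae ?_)) hx
          filter_upwards [coeFn_multilinear_sum T f fun i k => X i k ω] with y hy
          rw [hy]
        · have h1 : Hn i ω ≤ K i * N i ^ q i / η := Set.mem_iInter.1 hω i
          rw [Lp.enorm_def, eLpNorm_congr_ae (coeFn_Lp_sum_smul _ _), eLpNorm_ofReal_eq (hq i)]
          refine (ENNReal.rpow_le_rpow h1 (one_div_nonneg.2 (hq i).le)).trans_eq ?_
          rw [ENNReal.mul_div_right_comm, ENNReal.mul_rpow_of_nonneg _ _ (one_div_nonneg.2 (hq i).le),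
            ← ENNReal.rpow_mul, mul_one_div_cancel (hq i).ne', ENNReal.rpow_one]
    _ ≤ B := by
        rw [setLIntegral_const]
        exact mul_le_of_le_one_right zero_le prob_le_one

/-! ### From finite to countable families -/

theorem lrNorm_eq_iSup {κ Ω : Type*} {r : ℝ} (hr : 0 < r) (g : κ → Ω → ℝ) (y : Ω) :
    lrNorm r g y = ⨆ t : Finset κ, (∑ k ∈ t, ‖g k y‖ₑ ^ r) ^ (1 / r) := by
  rw [lrNorm, ENNReal.tsum_eq_iSup_sum]
  exact (ENNReal.orderIsoRpow (1 / r) (by positivity)).map_iSup _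

theorem lrNorm_comp_le {κ κ' Ω : Type*} {r : ℝ} (hr : 0 < r) (g : κ → Ω → ℝ) {e : κ' → κ}
    (he : e.Injective) (y : Ω) : lrNorm r (fun k => g (e k)) y ≤ lrNorm r g y :=
  ENNReal.rpow_le_rpow
    (ENNReal.tsum_comp_le_tsum_of_injective he fun k => ‖g k y‖ₑ ^ r) (by positivity)

theorem measurable_lrNorm {κ Ω : Type*} [Countable κ] [MeasurableSpace Ω] {r : ℝ}
    {g : κ → Ω → ℝ} (hg : ∀ k, Measurable (g k)) : Measurable (lrNorm r g) :=
  (Measurable.tsum fun k => by fun_prop).pow_const _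

/-- A finite set of multi-indices lies in the product of its coordinate projections, so finite
families indexed by products suffice. -/
theorem sum_rpow_le_lrNorm_subtype {m : ℕ} {κ : Fin m → Type*} {Ω : Type*} {r : ℝ} (hr : 0 < r)
    (g : (∀ i, κ i) → Ω → ℝ) (t : Finset (∀ i, κ i)) (s : ∀ i, Finset (κ i))
    (hs : ∀ k ∈ t, ∀ i, k i ∈ s i) (y : Ω) :
    (∑ k ∈ t, ‖g k y‖ₑ ^ r) ^ (1 / r)
      ≤ lrNorm r (fun (k : ∀ i, {x // x ∈ s i}) => g fun i => (k i).1) y := by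
  refine ENNReal.rpow_le_rpow ?_ (by positivity)
  rw [← Finset.tsum_subtype t fun k => ‖g k y‖ₑ ^ r]
  have hinj : Function.Injective
      (fun k : {x // x ∈ t} => fun i => (⟨k.1 i, hs k.1 k.2 i⟩ : {x // x ∈ s i})) := by
    intro k k' h
    refine Subtype.ext (funext fun i => ?_)
    exact congrArg Subtype.val (congrFun h i)
  exact ENNReal.tsum_comp_le_tsum_of_injective hinj
    fun k : ∀ i, {x // x ∈ s i} => ‖g (fun i => (k i).1) y‖ₑ ^ r

/-- Bounds for a multilinear operator on single functions transfer to countable families. -/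
theorem exists_transfer (m : ℕ) {r : ℝ} (q : Fin m → ℝ) (hr : 0 < r) (hq : ∀ i, 0 < q i)
    (h : (r < 2 ∧ ∀ i, q i < r) ∨ r = 2) :
    ∃ (c τ : ℝ≥0∞) (M : Fin m → ℝ≥0∞), c ≠ 0 ∧ c ≠ ∞ ∧ τ ≠ 0 ∧ τ ≠ ∞ ∧ (∀ i, M i ≠ ∞) ∧
      ∀ (Ω : Fin m → Type u) [∀ i, MeasurableSpace (Ω i)]
        (μ : ∀ i, Measure (Ω i)) [∀ i, SigmaFinite (μ i)]
        (Ω' : Type v) [MeasurableSpace Ω'] (ν : Measure Ω') [SigmaFinite ν]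
        (κ : Fin m → Type w) [∀ i, Countable (κ i)]
        (f : ∀ i, κ i → Lp ℝ (ENNReal.ofReal (q i)) (μ i))
        (T : MultilinearMap ℝ (fun i => Lp ℝ (ENNReal.ofReal (q i)) (μ i)) (Ω' →ₘ[ν] ℝ))
        (F : ℝ≥0∞ → ℝ≥0∞) (_ : Monotone F)
        (_ : ∀ a : Finset (∀ i, κ i) → ℝ≥0∞, F (⨆ s, a s) = ⨆ s, F (a s)) (B : ℝ≥0∞)
        (_ : ∀ x : ∀ i, Lp ℝ (ENNReal.ofReal (q i)) (μ i),
          (∀ i, ‖x i‖ₑ ≤ M i * eLpNorm (lrNorm r fun k : κ i => (f i k : Ω i → ℝ))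
            (ENNReal.ofReal (q i)) (μ i)) → ∫⁻ y, F ‖(T x : Ω' → ℝ) y‖ₑ ∂ν ≤ B),
        τ * ∫⁻ y, F (c * lrNorm r (fun (k : ∀ i, κ i) => (T fun i => f i (k i) : Ω' → ℝ)) y) ∂ν
          ≤ B := by
  classical
  obtain ⟨c, τ, M, hc, hc', hτ, hτ', hM, H⟩ := exists_finite_transfer.{u, v, w} m q hr hq h
  refine ⟨c, τ, M, hc, hc', hτ, hτ', hM, ?_⟩
  intro Ω _ μ _ Ω' _ ν _ κ _ f T F hF hFs B hB
  set g : (∀ i, κ i) → Ω' → ℝ := fun k => (T fun i => f i (k i) : Ω' →ₘ[ν] ℝ) with hg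
  have hgm : ∀ k, Measurable (g k) := fun k => (AEEqFun.stronglyMeasurable _).measurable
  have hFm : Measurable F := hF.measurable
  have h1 : ∀ y, F (c * lrNorm r g y)
      = ⨆ t : Finset (∀ i, κ i), F (c * (∑ k ∈ t, ‖g k y‖ₑ ^ r) ^ (1 / r)) := by
    intro y
    rw [lrNorm_eq_iSup hr, ENNReal.mul_iSup, hFs]
  have hmono : Monotone fun (t : Finset (∀ i, κ i)) (y : Ω') =>
      F (c * (∑ k ∈ t, ‖g k y‖ₑ ^ r) ^ (1 / r)) := by
    intro t t' htt' y
    refine hF (mul_le_mul_right (ENNReal.rpow_le_rpow ?_ (by positivity)) _)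
    exact Finset.sum_le_sum_of_subset htt'
  simp_rw [h1]
  -- Monotone convergence along finite sets of multi-indices, of which there are countably many.
  rw [lintegral_iSup_directed (fun t => Measurable.aemeasurable (by fun_prop)) hmono.directed_le,
    ENNReal.mul_iSup]
  refine iSup_le fun t => ?_
  set s : ∀ i, Finset (κ i) := fun i => t.image fun k => k i with hs
  refine le_trans ?_ (H Ω μ Ω' ν (fun i => {x // x ∈ s i}) (fun i k => f i k.1) T F hF B
    fun x hx => hB x fun i => (hx i).trans ?_)
  · gcongr with y
    exact hF (mul_le_mul_right (sum_rpow_le_lrNorm_subtype hr g t s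
      (fun k hk i => Finset.mem_image_of_mem _ hk) y) _)
  · gcongr
    refine eLpNorm_mono_enorm fun y => ?_
    simp only [enorm_eq_self]
    exact lrNorm_comp_le hr (fun k : κ i => (f i k : Ω i → ℝ)) Subtype.val_injective y

/-! ### Operator norms and the two conclusions -/

/-- The infimum is itself an admissible bound: it is over a nonempty set, and multiplication by the
finite product commutes with it. -/
theorem enorm_le_multilinearOpNorm_mul {ι : Type*} [Fintype ι] {E : ι → Type*} {F : Type*}
    [∀ i, AddCommMonoid (E i)] [∀ i, Module ℝ (E i)] [AddCommMonoid F] [Module ℝ F]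
    [∀ i, ENorm (E i)] [ENorm F] {T : MultilinearMap ℝ E F} (hT : IsBoundedMultilinear T)
    (x : ∀ i, E i) (hx : ∀ i, ‖x i‖ₑ ≠ ∞) : ‖T x‖ₑ ≤ multilinearOpNorm T * ∏ i, ‖x i‖ₑ := by
  have hne : {B : ℝ≥0∞ | ∀ x : ∀ i, E i, ‖T x‖ₑ ≤ B * ∏ i, ‖x i‖ₑ}.Nonempty := by
    by_contra hempty
    rw [IsBoundedMultilinear, multilinearOpNorm, Set.not_nonempty_iff_eq_empty.1 hempty] at hT
    simp at hT
  have := hne.to_subtype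
  rw [multilinearOpNorm, sInf_eq_iInf',
    ENNReal.iInf_mul fun h => absurd h (ENNReal.prod_ne_top fun i _ => hx i)]
  exact le_iInf fun B => B.2 x

theorem enorm_le_of_forall_enorm_le {m : ℕ} {E : Fin m → Type*} {F : Type*}
    [∀ i, AddCommMonoid (E i)] [∀ i, Module ℝ (E i)] [AddCommMonoid F] [Module ℝ F]
    [∀ i, ENorm (E i)] [ENorm F] {T : MultilinearMap ℝ E F} (hT : IsBoundedMultilinear T)
    (x : ∀ i, E i) (hx : ∀ i, ‖x i‖ₑ ≠ ∞) {M N : Fin m → ℝ≥0∞} (h : ∀ i, ‖x i‖ₑ ≤ M i * N i) :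
    ‖T x‖ₑ ≤ multilinearOpNorm T * ((∏ i, M i) * ∏ i, N i) := by
  refine (enorm_le_multilinearOpNorm_mul hT x hx).trans ?_
  rw [← Finset.prod_mul_distrib]
  gcongr with i
  exact h i

theorem rpow_one_div_mul_le_of_mul_le_rpow {τ I A : ℝ≥0∞} {p : ℝ} (hp : 0 < p)
    (h : τ * I ≤ A ^ p) : τ ^ (1 / p) * I ^ (1 / p) ≤ A := by
  have := ENNReal.rpow_le_rpow h (by positivity : 0 ≤ 1 / p)
  rwa [← ENNReal.rpow_mul, mul_one_div_cancel hp.ne', ENNReal.rpow_one,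
    ENNReal.mul_rpow_of_nonneg _ _ (by positivity)] at this

theorem le_mul_of_mul_le_mul_mul {a D S M N C : ℝ≥0∞} (ha : a ≠ 0) (ha' : a ≠ ∞)
    (hC : a⁻¹ * M ≤ C) (h : a * D ≤ S * (M * N)) : D ≤ C * S * N := by
  calc D = a⁻¹ * (a * D) := by rw [← mul_assoc, ENNReal.inv_mul_cancel ha ha', one_mul]
    _ ≤ a⁻¹ * (S * (M * N)) := by gcongr
    _ = a⁻¹ * M * S * N := by ring
    _ ≤ _ := by gcongr

theorem proposition5p3 (m : ℕ) (p r : ℝ) (q : Fin m → ℝ)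
    (hp : 0 < p) (hq : ∀ i, 0 < q i)
    (h : (r < 2 ∧ p < r ∧ ∀ i, q i < r) ∨ r = 2) :
    ∃ C : ℝ, 0 < C ∧
      ∀ (Ω : Fin m → Type u) [∀ i, MeasurableSpace (Ω i)]
        (μ : ∀ i, Measure (Ω i)) [∀ i, SigmaFinite (μ i)]
        (Ω' : Type v) [MeasurableSpace Ω'] (ν : Measure Ω') [SigmaFinite ν]
        (κ : Fin m → Type w) [∀ i, Countable (κ i)]
        (f : ∀ i, κ i → Lp ℝ (ENNReal.ofReal (q i)) (μ i)),
        (∀ T : MultilinearMap ℝ (fun i => Lp ℝ (ENNReal.ofReal (q i)) (μ i))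
              (Lp ℝ (ENNReal.ofReal p) ν),
          IsBoundedMultilinear T →
          eLpNorm (lrNorm r fun (k : ∀ i, κ i) => (T fun i => f i (k i) : Ω' → ℝ))
              (ENNReal.ofReal p) ν
            ≤ ENNReal.ofReal C * multilinearOpNorm T *
              ∏ i, eLpNorm (lrNorm r fun k : κ i => (f i k : Ω i → ℝ))
                (ENNReal.ofReal (q i)) (μ i)) ∧
        (∀ T : MultilinearMap ℝ (fun i => Lp ℝ (ENNReal.ofReal (q i)) (μ i))
              (WeakLp p hp ν),
          IsBoundedMultilinear T →
          eWeakLpNorm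
              (lrNorm r fun (k : ∀ i, κ i) => ((T fun i => f i (k i) : Ω' →ₘ[ν] ℝ) : Ω' → ℝ)) p ν
            ≤ ENNReal.ofReal (C * Real.exp (1 / p)) * multilinearOpNorm T *
              ∏ i, eLpNorm (lrNorm r fun k : κ i => (f i k : Ω i → ℝ))
                (ENNReal.ofReal (q i)) (μ i)) := by
  have hr : 0 < r := by
    rcases h with h | h
    · exact hp.trans h.2.1
    · rw [h]
      exact two_pos
  obtain ⟨c, τ, M, hc, hc', hτ, hτ', hM, H⟩ := exists_transfer.{u, v, w} m q hr hq
    (h.imp_left fun h => ⟨h.1, h.2.2⟩)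
  have ha : τ ^ (1 / p) * c ≠ 0 :=
    mul_ne_zero (by simp [ENNReal.rpow_eq_zero_iff, hτ, hτ']) hc
  have ha' : τ ^ (1 / p) * c ≠ ∞ :=
    ENNReal.mul_ne_top (ENNReal.rpow_ne_top_of_nonneg (by positivity) hτ') hc'
  set C₀ := (τ ^ (1 / p) * c)⁻¹ * ∏ i, M i with hC₀
  have hC₀t : C₀ ≠ ∞ :=
    ENNReal.mul_ne_top (ENNReal.inv_ne_top.2 ha) (ENNReal.prod_ne_top fun i _ => hM i)
  have hC : C₀ ≤ ENNReal.ofReal (C₀.toReal + 1) := by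
    conv_lhs => rw [← ENNReal.ofReal_toReal hC₀t]
    exact ENNReal.ofReal_le_ofReal (by linarith)
  -- The argument gives the weak bound with the same constant; the factor `e ^ (1/p) ≥ 1` only
  -- weakens it.
  have hC' : C₀ ≤ ENNReal.ofReal ((C₀.toReal + 1) * Real.exp (1 / p)) := by
    refine hC.trans (ENNReal.ofReal_le_ofReal (le_mul_of_one_le_right (by positivity) ?_))
    exact Real.one_le_exp (by positivity)
  refine ⟨C₀.toReal + 1, by positivity, fun Ω _ μ _ Ω' _ ν _ κ _ f => ⟨fun T hT => ?_,
    fun T hT => ?_⟩⟩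
  · let J : Lp ℝ (ENNReal.ofReal p) ν →ₗ[ℝ] (Ω' →ₘ[ν] ℝ) :=
      { toFun := fun g => g, map_add' := fun _ _ => rfl, map_smul' := fun _ _ => rfl }
    refine le_mul_of_mul_le_mul_mul ha ha' hC ?_
    have key := H Ω μ Ω' ν κ f (J.compMultilinearMap T) (fun x => x ^ p)
      (ENNReal.monotone_rpow_of_nonneg hp.le)
      (fun a => (ENNReal.orderIsoRpow p hp).map_iSup a) _
      fun x hx => by
        have h1 := enorm_le_of_forall_enorm_le hT x (fun i => enorm_ne_top) hx
        rw [Lp.enorm_def] at h1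
        have h2 := ENNReal.rpow_le_rpow h1 hp.le
        rw [eLpNorm_ofReal_rpow hp] at h2
        exact h2
    have h3 := rpow_one_div_mul_le_of_mul_le_rpow hp key
    refine le_trans (le_of_eq ?_) h3
    simp_rw [ENNReal.mul_rpow_of_nonneg _ _ hp.le]
    rw [lintegral_const_mul' _ _ (ENNReal.rpow_ne_top_of_nonneg hp.le hc'),
      ENNReal.mul_rpow_of_nonneg _ _ (by positivity : 0 ≤ 1 / p), ← ENNReal.rpow_mul,
      mul_one_div_cancel hp.ne', ENNReal.rpow_one, ← mul_assoc, eLpNorm_ofReal_eq hp]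
    rfl
  · refine iSup₂_le fun t ht => le_mul_of_mul_le_mul_mul ha ha' hC' ?_
    -- With this level, `c · lrNorm > u` means `lrNorm > t`.
    set u := c * ENNReal.ofReal t with hu
    have hu0 : u ≠ 0 := mul_ne_zero hc (by simpa using ht)
    have hut : u ≠ ∞ := ENNReal.mul_ne_top hc' ENNReal.ofReal_ne_top
    -- The half-line is open, so a supremum exceeds `u` only if some member does; this makes the
    -- indicator commute with suprema.
    have hFmono : Monotone ((Set.Ioi u).indicator (1 : ℝ≥0∞ → ℝ≥0∞)) := by
      intro x y hxy
      by_cases hx : x ∈ Set.Ioi u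
      · rw [Set.indicator_of_mem hx, Set.indicator_of_mem (Set.mem_Ioi.2 (lt_of_lt_of_le (Set.mem_Ioi.1 hx) hxy))]
        rfl
      · rw [Set.indicator_of_notMem hx]
        exact zero_le
    have key := H Ω μ Ω' ν κ f ((WeakLp p hp ν).subtype.compMultilinearMap T)
      ((Set.Ioi u).indicator 1) hFmono
      (fun a => by
        refine le_antisymm ?_ (iSup_le fun s => hFmono (le_iSup a s))
        by_cases hx : (⨆ s, a s) ∈ Set.Ioi u
        · obtain ⟨s, hs⟩ := lt_iSup_iff.1 (Set.mem_Ioi.1 hx)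
          refine le_iSup_of_le s ?_
          rw [Set.indicator_of_mem hx, Set.indicator_of_mem (Set.mem_Ioi.2 hs)]
          rfl
        · rw [Set.indicator_of_notMem hx]
          exact zero_le)
      -- The weak-type bound on `ν(|T x| > u)` for admissible `x`.
      ((multilinearOpNorm T * ((∏ i, M i) * ∏ i, eLpNorm (lrNorm r fun k : κ i =>
        (f i k : Ω i → ℝ)) (ENNReal.ofReal (q i)) (μ i)) / u) ^ p)
      fun x hx => by
        have h1 := enorm_le_of_forall_enorm_le hT x (fun i => enorm_ne_top) hx
        have h2 : u * ν {y | u < ‖((T x : Ω' →ₘ[ν] ℝ) : Ω' → ℝ) y‖ₑ} ^ (1 / p) ≤ ‖T x‖ₑ := by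
          rw [← ENNReal.ofReal_toReal hut]
          exact le_iSup₂_of_le (f := fun (s : ℝ) (_ : 0 < s) => ENNReal.ofReal s *
            ν {ω | ENNReal.ofReal s < ‖((T x : Ω' →ₘ[ν] ℝ) : Ω' → ℝ) ω‖ₑ} ^ (1 / p)) u.toReal
            (ENNReal.toReal_pos hu0 hut) le_rfl
        have hm : MeasurableSet {y | u < ‖((T x : Ω' →ₘ[ν] ℝ) : Ω' → ℝ) y‖ₑ} :=
          measurableSet_lt measurable_const
            (AEEqFun.stronglyMeasurable (T x : Ω' →ₘ[ν] ℝ)).measurable.enorm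
        have h3 : ν {y | u < ‖((T x : Ω' →ₘ[ν] ℝ) : Ω' → ℝ) y‖ₑ} ^ (1 / p) ≤ _ :=
          (ENNReal.le_div_iff_mul_le (Or.inl hu0) (Or.inl hut)).2
            ((mul_comm _ _).trans_le (h2.trans h1))
        have h4 := ENNReal.rpow_le_rpow h3 hp.le
        rw [← ENNReal.rpow_mul, one_div_mul_cancel hp.ne', ENNReal.rpow_one,
          ← lintegral_indicator_one hm] at h4
        exact h4
    have h3 := rpow_one_div_mul_le_of_mul_le_rpow hp key
    rw [ENNReal.le_div_iff_mul_le (Or.inl hu0) (Or.inl hut)] at h3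
    refine le_trans (le_of_eq ?_) h3
    set g : (∀ i, κ i) → Ω' → ℝ := fun k => ((T fun i => f i (k i) : Ω' →ₘ[ν] ℝ) : Ω' → ℝ)
    have hgm : ∀ k, Measurable (g k) := fun k => (AEEqFun.stronglyMeasurable _).measurable
    have hI : ∫⁻ y, (Set.Ioi u).indicator 1 (c * lrNorm r g y) ∂ν
        = ν {y | ENNReal.ofReal t < ‖lrNorm r g y‖ₑ} := by
      have hm : MeasurableSet {y | ENNReal.ofReal t < ‖lrNorm r g y‖ₑ} :=
        measurableSet_lt measurable_const (measurable_lrNorm hgm)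
      rw [← lintegral_indicator_one hm]
      refine lintegral_congr fun y => ?_
      have hiff : c * lrNorm r g y ∈ Set.Ioi u ↔ y ∈ {y | ENNReal.ofReal t < ‖lrNorm r g y‖ₑ} :=
        ENNReal.mul_lt_mul_iff_right hc hc'
      by_cases hy : y ∈ {y | ENNReal.ofReal t < ‖lrNorm r g y‖ₑ}
      · rw [Set.indicator_of_mem hy, Set.indicator_of_mem (hiff.2 hy)]
        rfl
      · rw [Set.indicator_of_notMem hy, Set.indicator_of_notMem fun h => hy (hiff.1 h)]
    rw [← hI, hu]
    change _ = τ ^ (1 / p) * (∫⁻ y, (Set.Ioi u).indicator 1 (c * lrNorm r g y) ∂ν) ^ (1 / p) * _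
    ring
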